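/- For a function $\vartheta:[0,\infty)\to\mathbb{R}$ with $\vartheta(0)=0$, let $\varphi=\iota[\vartheta]$ be the additive arithmetic function with $\varphi(p^{\ell})=\vartheta(\ell\log p)$ for primes $p$ and integers $\ell\ge 0$, that is, $\varphi(k)=\sum_{p}\vartheta(\alpha_p(k)\log p)$ for $k\geq 1$, where $\alpha_p(k)$ is the exponent of $p$ in $k$. Call $L$ slowly varying if $L(tx)/L(x)\to 1$ as $x\to\infty$ for every $t>0$ (so that $L$ is nonzero near infinity; $L$ may be negative there). Let $\mathcal{V}$ be the set of functions $\vartheta=F\cdot L$ on $[0,\infty)$ with $L$ slowly varying and $\lim_{x\to\infty}x^{-\alpha}F(x)=1$ for some real $\alpha\geq 0$; the degree $\partial\vartheta$ of $\vartheta\in\mathcal{V}$ is the unique real $\alpha\ge 0$ such that $\vartheta(x)/x^{\alpha}$ is slowly varying. Let $\vartheta\in\mathcal{V}$ satisfy $\vartheta(0)=0$, be continuously differentiable on $(0,\infty)$, monotone (decreasing or increasing) in a neighborhood of infinity, and have degree $\partial\vartheta>0$. For $n\ge 1$ let $H_n$ be harmonically distributed on $\{1,\dots,n\}$, that is, $\mathbb{P}[H_n=k]=\frac{1}{kL_n}$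 for $1\le k\le n$ with $L_n=\sum_{k=1}^n \frac1k$. Let $\eta$ be a Poisson random measure on $\mathcal{X}=(0,1]^2$ with intensity $\mu(ds,dx)=\frac{1}{x}\,ds\,dx$. Then $\int_{\mathcal{X}}x^{\partial\vartheta}\,\eta(ds,dx)$ and $\int_{\mathcal{X}}x\,\eta(ds,dx)$ are almost surely finite, the event $\{\int_{\mathcal{X}}x\,\eta(ds,dx)\le 1\}$ has positive probability, and, as $n\to\infty$, \[ \frac{\varphi(H_n)}{\vartheta(\log n)}\ \xrightarrow{\ \mathrm{Law}\ }\ \mathcal{L}\Big(\int_{\mathcal{X}}x^{\partial\vartheta}\,\eta(ds,dx)\ \Big|\ \int_{\mathcal{X}}x\,\eta(ds,dx)\leq 1\Big). \] -/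

import Mathlib

open MeasureTheory ProbabilityTheory Filter Topology
open scoped ENNReal NNReal

namespace HarmonicAdditive

/-! ### The harmonic distribution and the additive functions -/

/-- The normalising constant `L_n = ∑_{k=1}^n 1/k`. -/
noncomputable def harmonicConst (n : ℕ) : ℝ := ∑ k ∈ Finset.Icc 1 n, 1 / (k : ℝ)

/-- The harmonic distribution on `{1, …, n}` (for `n ≥ 1`): mass `1 / (k L_n)` at `k`. -/
noncomputable def harmonicLaw (n : ℕ) : Measure ℕ :=
  ∑ k ∈ Finset.Icc 1 n, ENNReal.ofReal (1 / ((k : ℝ) * harmonicConst n)) • Measure.dirac k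

/-- The additive arithmetic function with value `θ (ℓ log p)` at `p ^ ℓ`. -/
noncomputable def iota (θ : ℝ → ℝ) (k : ℕ) : ℝ :=
  k.factorization.sum fun p l => θ ((l : ℝ) * Real.log p)

/-! ### Slow variation, the class `𝒱` and the degree -/

/-- `L` is slowly varying at infinity. As division by zero gives zero, the limit forces `L` to be
nonzero near infinity; either sign is allowed, and no measurability is required. -/
def SlowlyVarying (L : ℝ → ℝ) : Prop :=
  ∀ t : ℝ, 0 < t → Tendsto (fun x => L (t * x) / L x) atTop (𝓝 1)

/-- Functions `θ = F · L` on `[0, ∞)` with `x ^ (-α) F x → 1` for some `α ≥ 0` and `L` slowly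
varying. -/
def ClassV : Set (ℝ → ℝ) :=
  {θ | ∃ α : ℝ, 0 ≤ α ∧ ∃ F L : ℝ → ℝ,
    (∀ x, 0 ≤ x → θ x = F x * L x) ∧
    Tendsto (fun x => x ^ (-α) * F x) atTop (𝓝 1) ∧ SlowlyVarying L}

/-- `α ≥ 0` and `θ x / x ^ α` is slowly varying. -/
def IsDegree (θ : ℝ → ℝ) (α : ℝ) : Prop :=
  0 ≤ α ∧ SlowlyVarying fun x => θ x / x ^ α

open Classical in
/-- The degree of `θ`: the unique `α ≥ 0` such that `θ x / x ^ α` is slowly varying. -/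
noncomputable def degree (θ : ℝ → ℝ) : ℝ :=
  if h : ∃ α, IsDegree θ α then h.choose else 0

theorem IsDegree.tendsto {θ : ℝ → ℝ} {α : ℝ} (h : IsDegree θ α) :
    Tendsto (fun x => θ (2 * x) / θ x) atTop (𝓝 ((2 : ℝ) ^ α)) := by
  have h1 := (h.2 2 (by norm_num)).mul_const ((2 : ℝ) ^ α)
  rw [one_mul] at h1
  refine h1.congr' ?_
  filter_upwards [eventually_gt_atTop 0] with x hx
  have hx' : x ^ α ≠ 0 := (Real.rpow_pos_of_pos hx α).ne'
  have h2 : (2 : ℝ) ^ α ≠ 0 := (Real.rpow_pos_of_pos (by norm_num) α).ne'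
  rw [Real.mul_rpow (by norm_num) hx.le]
  by_cases h0 : θ x = 0
  · simp [h0]
  · field_simp

theorem IsDegree.unique {θ : ℝ → ℝ} {α β : ℝ} (h : IsDegree θ α) (h' : IsDegree θ β) :
    α = β := by
  have h2 := tendsto_nhds_unique h.tendsto h'.tendsto
  exact (Real.rpow_right_inj (by norm_num) (by norm_num)).1 h2

theorem IsDegree.degree_eq {θ : ℝ → ℝ} {α : ℝ} (h : IsDegree θ α) : degree θ = α := by
  have hex : ∃ α, IsDegree θ α := ⟨α, h⟩
  rw [degree, dif_pos hex]
  exact hex.choose_spec.unique h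

/-- Every member of the class has a degree. -/
theorem isDegree_degree {θ : ℝ → ℝ} (h : θ ∈ ClassV) : IsDegree θ (degree θ) := by
  obtain ⟨α, hα, F, L, hθ, hF, hL⟩ := h
  have key : IsDegree θ α := by
    refine ⟨hα, fun t ht => ?_⟩
    have hF' := hF.comp (tendsto_id.const_mul_atTop ht)
    have h1 := (hF'.div hF one_ne_zero).mul (hL t ht)
    rw [div_one, one_mul] at h1
    refine h1.congr' ?_
    filter_upwards [eventually_gt_atTop 0] with x hx
    have htx : 0 < t * x := mul_pos ht hx
    simp only [Function.comp_apply, id_eq, Pi.div_apply]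
    rw [hθ _ htx.le, hθ _ hx.le, Real.rpow_neg htx.le, Real.rpow_neg hx.le, div_mul_div_comm]
    congr 1 <;> ring
  rwa [key.degree_eq]

/-! ### Poisson random measures -/

/-- `η` is a Poisson random measure with intensity `μ` on the probability space `(Ω, P)`:
a measurable map into measures such that `η B` is Poisson distributed with mean `μ B` (being almost
surely infinite if `μ B = ∞`) and the values on disjoint sets are independent. -/
structure IsPoissonRandomMeasure {Ω E : Type*} [MeasurableSpace Ω] [MeasurableSpace E]
    (η : Ω → Measure E) (μ : Measure E) (P : Measure Ω) : Prop where
  measurable : Measurable η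
  hasLaw : ∀ B, MeasurableSet B → μ B ≠ ∞ →
    HasLaw (fun ω => η ω B)
      ((poissonMeasure (μ B).toNNReal).map (Nat.cast : ℕ → ℝ≥0∞)) P
  eq_top : ∀ B, MeasurableSet B → μ B = ∞ → ∀ᵐ ω ∂P, η ω B = ∞
  indep : ∀ (m : ℕ) (B : Fin m → Set E), (∀ i, MeasurableSet (B i)) →
    Pairwise (fun i j => Disjoint (B i) (B j)) → iIndepFun (fun i ω => η ω (B i)) P

/-- The unit square `(0, 1]²`. -/
def unitSquare : Set (ℝ × ℝ) := Set.Ioc 0 1 ×ˢ Set.Ioc 0 1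

/-- The intensity `dt dx / x` on `(0, 1]²`. -/
noncomputable def dickmanIntensity : Measure (ℝ × ℝ) :=
  (volume.restrict unitSquare).withDensity fun z => ENNReal.ofReal (1 / z.2)

end HarmonicAdditive

/-! The harmonic law on `{1, …, n}` is the law `Q_n` with mass proportional to `1 / k` on the
`n`-smooth numbers, conditioned on `k ≤ n` (`harmonicLaw_mul_smoothLaw`). Under `Q_n` the exponents
of the primes `p ≤ n` are independent and geometric, so the joint characteristic function of `(φ(k)
/ θ(log n), log k / log n)` is a finite Euler product.

Each factor agrees with the compound Poisson factor `exp ((e^{iu} - 1) / p)` up to `O(p⁻²)`, and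
each fixed factor tends to 1. By dominated convergence only the exponent `∑ (e^{iu_p} - 1) / p`
matters (`tendsto_prod_geomCharFun`). With `y = log n`, Mertens' theorem says that the points `log p
/ y` with weights `1 / p` approach `dx / x` on `(0, 1]`, while regular variation turns `θ(x y) /
θ(y)` into `x ^ α`. The exponent therefore tends to `∫₀¹ (e^{i(s x^α + t x)} - 1) dx / x`
(`RegularlyGrowing.tendsto_sum_primes`), which is the exponent of the pair `(∫ x^α dη, ∫ x dη)`
(`IsPoissonRandomMeasure.charFun_dickman`). Lévy's continuity theorem gives joint convergence under
`Q_n`.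

The condition `k ≤ n` reads `log k / log n ≤ 1`, so the conditional laws converge once `∫ x dη` has
no atom at 1. This is read off the arithmetic side: `Q_n` gives mass at most `1 / log n + 2δ` to
numbers between `n^{1-δ}` and `n^{1+δ}`. A function decreasing near infinity is reduced to an
increasing one by changing its sign. -/

namespace HarmonicAdditive

/-! ### Poisson random measures: Campbell's formula and the characteristic functional. -/

section Poisson

variable {Ω E : Type*} [MeasurableSpace Ω] [MeasurableSpace E] {η : Ω → Measure E} {μ : Measure E}
  {P : Measure Ω}

theorem lintegral_natCast_poissonMeasure (r : ℝ≥0) :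
    ∫⁻ n : ℕ, (n : ℝ≥0∞) ∂(poissonMeasure r) = r := by
  have hs : HasSum (fun n : ℕ => Real.exp (-r) * (r : ℝ) ^ n / n.factorial * n) r := by
    rw [← hasSum_nat_add_iff' 1]
    have h := (hasSum_one_poissonMeasure r).mul_left (r : ℝ)
    simp only [mul_one] at h
    simp only [Finset.range_one, Finset.sum_singleton, CharP.cast_eq_zero, mul_zero, sub_zero]
    refine h.congr_fun ?_
    intro n
    rw [Nat.factorial_succ]
    push_cast
    have h1 : ((n.factorial : ℝ)) ≠ 0 := by positivity
    have h2 : ((n : ℝ) + 1) ≠ 0 := by positivity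
    field_simp
    ring
  have h0 : ∀ n : ℕ, 0 ≤ Real.exp (-r) * (r : ℝ) ^ n / n.factorial * n := fun n => by positivity
  calc ∫⁻ n : ℕ, (n : ℝ≥0∞) ∂(poissonMeasure r)
      = ∑' n : ℕ, (n : ℝ≥0∞) * poissonMeasure r {n} := lintegral_countable' _
    _ = ∑' n : ℕ, ENNReal.ofReal (Real.exp (-r) * (r : ℝ) ^ n / n.factorial * n) := by
        refine tsum_congr fun n => ?_
        rw [poissonMeasure_singleton, mul_comm, ENNReal.ofReal_mul (by positivity),
          ENNReal.ofReal_natCast]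
    _ = r := by
        rw [← ENNReal.ofReal_tsum_of_nonneg h0 hs.summable, hs.tsum_eq, ENNReal.ofReal_coe_nnreal]

/-- **Campbell formula**: the mean measure of a Poisson random measure is its intensity. -/
theorem IsPoissonRandomMeasure.bind_eq [IsProbabilityMeasure P]
    (hη : IsPoissonRandomMeasure η μ P) : P.bind η = μ := by
  ext B hB
  rw [Measure.bind_apply hB hη.measurable.aemeasurable]
  by_cases hμ : μ B = ∞
  · rw [hμ, lintegral_congr_ae (hη.eq_top B hB hμ)]
    simp
  · have h := hη.hasLaw B hB hμ
    have h1 : ∫⁻ ω, η ω B ∂P = ∫⁻ x, x ∂(P.map fun ω => η ω B) :=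
      (lintegral_map' aemeasurable_id h.aemeasurable).symm
    rw [h1, h.map_eq, lintegral_map measurable_id' Measurable.of_discrete]
    exact (lintegral_natCast_poissonMeasure _).trans (ENNReal.coe_toNNReal hμ)

theorem IsPoissonRandomMeasure.lintegral_lintegral [IsProbabilityMeasure P]
    (hη : IsPoissonRandomMeasure η μ P) {f : E → ℝ≥0∞} (hf : Measurable f) :
    ∫⁻ ω, ∫⁻ z, f z ∂(η ω) ∂P = ∫⁻ z, f z ∂μ := by
  rw [← hη.bind_eq, Measure.lintegral_bind hη.measurable.aemeasurable hf.aemeasurable]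

theorem IsPoissonRandomMeasure.measurable_lintegral
    (hη : IsPoissonRandomMeasure η μ P) {f : E → ℝ≥0∞} (hf : Measurable f) :
    Measurable fun ω => ∫⁻ z, f z ∂(η ω) :=
  (Measure.measurable_lintegral hf).comp hη.measurable

/-- By Campbell's formula the random variable `∫ |f| dη` has finite mean, hence is almost surely
finite. -/
theorem IsPoissonRandomMeasure.ae_integrable [IsProbabilityMeasure P]
    (hη : IsPoissonRandomMeasure η μ P) {f : E → ℝ} (hf : Measurable f) (hi : Integrable f μ) :
    ∀ᵐ ω ∂P, Integrable f (η ω) := by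
  have h1 : ∫⁻ ω, ∫⁻ z, ‖f z‖ₑ ∂(η ω) ∂P ≠ ∞ := by
    rw [hη.lintegral_lintegral hf.enorm]
    exact hi.2.ne
  filter_upwards [ae_lt_top (hη.measurable_lintegral hf.enorm) h1] with ω hω
  exact ⟨hf.aestronglyMeasurable, hω⟩

theorem IsPoissonRandomMeasure.measurable_integral_of_nonneg
    (hη : IsPoissonRandomMeasure η μ P) {f : E → ℝ} (hf : Measurable f) (h0 : ∀ z, 0 ≤ f z) :
    Measurable fun ω => ∫ z, f z ∂(η ω) := by
  have h : (fun ω => ∫ z, f z ∂(η ω)) = fun ω => (∫⁻ z, ENNReal.ofReal (f z) ∂(η ω)).toReal := by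
    ext ω
    exact integral_eq_lintegral_of_nonneg_ae (Eventually.of_forall h0) hf.aestronglyMeasurable
  rw [h]
  exact (hη.measurable_lintegral hf.ennreal_ofReal).ennreal_toReal

theorem IsPoissonRandomMeasure.aemeasurable_integral [IsProbabilityMeasure P]
    (hη : IsPoissonRandomMeasure η μ P) {f : E → ℝ} (hf : Measurable f) (hi : Integrable f μ) :
    AEMeasurable (fun ω => ∫ z, f z ∂(η ω)) P := by
  have h1 := (hη.measurable_integral_of_nonneg (f := fun z => max (f z) 0)
    (hf.max measurable_const) fun _ => le_max_right _ _).sub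
    (hη.measurable_integral_of_nonneg (f := fun z => max (-f z) 0)
    (hf.neg.max measurable_const) fun _ => le_max_right _ _)
  refine h1.aemeasurable.congr ?_
  filter_upwards [hη.ae_integrable hf hi] with ω hω
  rw [Pi.sub_apply, ← integral_sub hω.pos_part hω.neg_part]
  refine integral_congr_ae (Eventually.of_forall fun z => ?_)
  have := max_zero_sub_max_neg_zero_eq_self (f z)
  exact this

theorem IsPoissonRandomMeasure.integral_integral_of_nonneg [IsProbabilityMeasure P]
    (hη : IsPoissonRandomMeasure η μ P) {f : E → ℝ} (hf : Measurable f) (hi : Integrable f μ)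
    (h0 : ∀ z, 0 ≤ f z) :
    Integrable (fun ω => ∫ z, f z ∂(η ω)) P ∧ ∫ ω, ∫ z, f z ∂(η ω) ∂P = ∫ z, f z ∂μ := by
  have hm := hη.measurable_integral_of_nonneg hf h0
  have hn : ∀ ω, 0 ≤ ∫ z, f z ∂(η ω) := fun ω => integral_nonneg h0
  have hae : (fun ω => ENNReal.ofReal (∫ z, f z ∂(η ω))) =ᵐ[P]
      fun ω => ∫⁻ z, ENNReal.ofReal (f z) ∂(η ω) := by
    filter_upwards [hη.ae_integrable hf hi] with ω hω
    exact ofReal_integral_eq_lintegral_ofReal hω (Eventually.of_forall h0)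
  have hl : ∫⁻ ω, ENNReal.ofReal (∫ z, f z ∂(η ω)) ∂P = ∫⁻ z, ENNReal.ofReal (f z) ∂μ := by
    rw [lintegral_congr_ae hae, hη.lintegral_lintegral hf.ennreal_ofReal]
  have hfin : ∫⁻ z, ENNReal.ofReal (f z) ∂μ ≠ ∞ := by
    rw [← ofReal_integral_eq_lintegral_ofReal hi (Eventually.of_forall h0)]
    exact ENNReal.ofReal_ne_top
  constructor
  · rw [← lintegral_ofReal_ne_top_iff_integrable hm.aestronglyMeasurable
      (Eventually.of_forall hn), hl]
    exact hfin
  · rw [integral_eq_lintegral_of_nonneg_ae (Eventually.of_forall hn) hm.aestronglyMeasurable, hl,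
      integral_eq_lintegral_of_nonneg_ae (Eventually.of_forall h0) hf.aestronglyMeasurable]

theorem norm_exp_mul_I_sub_one_le (x : ℝ) :
    ‖Complex.exp (x * Complex.I) - 1‖ ≤ |x| := by
  rw [mul_comm]
  exact Real.norm_exp_I_mul_ofReal_sub_one_le

open Complex in
theorem IsPoissonRandomMeasure.integral_exp_apply
    (hη : IsPoissonRandomMeasure η μ P) {B : Set E} (hB : MeasurableSet B) (hμ : μ B ≠ ∞) (c : ℝ) :
    ∫ ω, cexp ((c * (η ω B).toReal : ℝ) * I) ∂P = cexp ((μ B).toReal * (cexp (c * I) - 1)) := by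
  have h := hη.hasLaw B hB hμ
  have hm : Measurable fun x : ℝ≥0∞ => cexp ((c * x.toReal : ℝ) * I) := by fun_prop
  have h1 : ∫ ω, cexp ((c * (η ω B).toReal : ℝ) * I) ∂P
      = ∫ x, cexp ((c * x.toReal : ℝ) * I) ∂(P.map fun ω => η ω B) :=
    (integral_map h.aemeasurable hm.aestronglyMeasurable).symm
  rw [h1, h.map_eq, integral_map Measurable.of_discrete.aemeasurable hm.aestronglyMeasurable]
  have h2 := charFun_map_cast_poissonMeasure (μ B).toNNReal c
  rw [charFun_apply, integral_map .of_discrete (by fun_prop)] at h2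
  simp_rw [Real.inner_apply, mul_comm _ c] at h2
  simpa [ENNReal.coe_toNNReal_eq_toReal] using h2

open Complex in
/-- The characteristic functional of a Poisson random measure on simple functions. -/
theorem IsPoissonRandomMeasure.integral_exp_simpleFunc [IsProbabilityMeasure P]
    (hη : IsPoissonRandomMeasure η μ P) (f : SimpleFunc E ℝ) (hi : Integrable f μ) :
    ∫ ω, cexp ((∫ z, f z ∂(η ω) : ℝ) * I) ∂P = cexp (∫ z, (cexp (f z * I) - 1) ∂μ) := by
  classical
  -- The fibre over 0 is discarded because it may have infinite intensity; the other fibres have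
  -- finite intensity by integrability.
  set s := f.range.filter (· ≠ 0) with hs
  have hfin : ∀ y ∈ s, μ (f ⁻¹' {y}) ≠ ∞ := fun y hy =>
    (SimpleFunc.measure_preimage_lt_top_of_integrable f hi (Finset.mem_filter.1 hy).2).ne
  have hL : ∀ᵐ ω ∂P, ∫ z, f z ∂(η ω) = ∑ y ∈ s, y * (η ω (f ⁻¹' {y})).toReal := by
    filter_upwards [hη.ae_integrable f.measurable hi] with ω hω
    rw [SimpleFunc.integral_eq_sum f hω, hs, Finset.sum_filter]
    refine Finset.sum_congr rfl fun y _ => ?_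
    by_cases hy : y = 0
    · simp [hy]
    · simp [hy, mul_comm, Measure.real]
  have hR : ∫ z, (cexp (f z * I) - 1) ∂μ
      = ∑ y ∈ s, (μ (f ⁻¹' {y})).toReal * (cexp (y * I) - 1) := by
    have h1 : Integrable (f.map fun y : ℝ => cexp (y * I) - 1) μ :=
      hi.mono (SimpleFunc.aestronglyMeasurable _)
        (Eventually.of_forall fun z => norm_exp_mul_I_sub_one_le (f z))
    have h2 := SimpleFunc.map_integral f (fun y : ℝ => cexp (y * I) - 1) hi (by simp)
    rw [SimpleFunc.integral_eq_integral _ h1] at h2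
    refine h2.trans ?_
    rw [hs, Finset.sum_filter]
    refine Finset.sum_congr rfl fun y _ => ?_
    by_cases hy : y = 0
    · simp [hy]
    · simp [hy, Measure.real]
  -- Distinct values have disjoint fibres, so their masses are independent Poisson variables and the
  -- expectation factorises.
  have hind : iIndepFun (fun (y : s) ω => η ω (f ⁻¹' {(y : ℝ)})) P := by
    have h := hη.indep s.card (fun j => f ⁻¹' {((s.equivFin.symm j : s) : ℝ)})
      (fun j => f.measurableSet_fiber _) fun i j hij => by
        refine Disjoint.preimage _ ?_
        rw [Set.disjoint_singleton]
        exact fun h => hij (s.equivFin.symm.injective (Subtype.ext h))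
    have h' := h.precomp s.equivFin.injective
    simpa [Function.comp_def] using h'
  have hm : ∀ y : s, Measurable fun ω => η ω (f ⁻¹' {(y : ℝ)}) := fun y =>
    (Measure.measurable_coe (f.measurableSet_fiber _)).comp hη.measurable
  calc ∫ ω, cexp ((∫ z, f z ∂(η ω) : ℝ) * I) ∂P
      = ∫ ω, ∏ y : s, cexp (((y : ℝ) * (η ω (f ⁻¹' {(y : ℝ)})).toReal : ℝ) * I) ∂P := by
        refine integral_congr_ae ?_
        filter_upwards [hL] with ω hω
        rw [hω, ← Complex.exp_sum, ← Finset.sum_coe_sort s, ← Finset.sum_mul, Complex.ofReal_sum]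
    _ = ∏ y : s, ∫ ω, cexp (((y : ℝ) * (η ω (f ⁻¹' {(y : ℝ)})).toReal : ℝ) * I) ∂P :=
        hind.integral_fun_prod_comp (f := fun (y : s) x => cexp (((y : ℝ) * x.toReal : ℝ) * I))
          (fun y => (hm y).aemeasurable) fun y => by fun_prop
    _ = ∏ y : s, cexp ((μ (f ⁻¹' {(y : ℝ)})).toReal * (cexp ((y : ℝ) * I) - 1)) :=
        Finset.prod_congr rfl fun y _ =>
          hη.integral_exp_apply (f.measurableSet_fiber _) (hfin y y.2) y
    _ = cexp (∫ z, (cexp (f z * I) - 1) ∂μ) := by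
        rw [hR, ← Complex.exp_sum, ← Finset.sum_coe_sort s]

open Complex in
/-- The characteristic functional of a Poisson random measure. -/
theorem IsPoissonRandomMeasure.integral_exp [IsProbabilityMeasure P]
    (hη : IsPoissonRandomMeasure η μ P) {f : E → ℝ} (hf : Measurable f) (hi : Integrable f μ) :
    ∫ ω, cexp ((∫ z, f z ∂(η ω) : ℝ) * I) ∂P = cexp (∫ z, (cexp (f z * I) - 1) ∂μ) := by
  -- Simple approximations dominated by `2|f|`: the same bound serves under `μ` and, almost surely,
  -- under `η ω`.
  set g : ℕ → SimpleFunc E ℝ := fun n => SimpleFunc.approxOn f hf Set.univ 0 (Set.mem_univ _) n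
    with hg
  have hgf : ∀ z, Tendsto (fun n => g n z) atTop (𝓝 (f z)) := fun z =>
    SimpleFunc.tendsto_approxOn hf _ (by simp)
  have hgb : ∀ n z, ‖g n z‖ ≤ ‖f z‖ + ‖f z‖ := fun n z =>
    SimpleFunc.norm_approxOn_zero_le hf (Set.mem_univ _) z n
  have hgi : ∀ n, Integrable (g n) μ := fun n =>
    (hi.norm.add hi.norm).mono' (g n).aestronglyMeasurable (Eventually.of_forall (hgb n))
  have hl : Tendsto (fun n => ∫ ω, cexp ((∫ z, g n z ∂(η ω) : ℝ) * I) ∂P) atTop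
      (𝓝 (∫ ω, cexp ((∫ z, f z ∂(η ω) : ℝ) * I) ∂P)) := by
    refine tendsto_integral_of_dominated_convergence (fun _ => 1) (fun n => ?_)
      (integrable_const _) (fun n => Eventually.of_forall fun ω => ?_) ?_
    · have := hη.aemeasurable_integral (g n).measurable (hgi n)
      exact (Measurable.comp_aemeasurable (g := fun x : ℝ => cexp (x * I)) (by fun_prop)
        this).aestronglyMeasurable
    · rw [Complex.norm_exp_ofReal_mul_I]
    · filter_upwards [hη.ae_integrable hf hi] with ω hω
      have h1 : Tendsto (fun n => ∫ z, g n z ∂(η ω)) atTop (𝓝 (∫ z, f z ∂(η ω))) :=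
        tendsto_integral_of_dominated_convergence (fun z => ‖f z‖ + ‖f z‖)
          (fun n => (g n).aestronglyMeasurable) (hω.norm.add hω.norm)
          (fun n => Eventually.of_forall (hgb n)) (Eventually.of_forall hgf)
      exact ((by fun_prop : Continuous fun x : ℝ => cexp (x * I)).tendsto _).comp h1
  have hr : Tendsto (fun n => cexp (∫ z, (cexp (g n z * I) - 1) ∂μ)) atTop
      (𝓝 (cexp (∫ z, (cexp (f z * I) - 1) ∂μ))) := by
    refine (Complex.continuous_exp.tendsto _).comp ?_
    refine tendsto_integral_of_dominated_convergence (fun z => ‖f z‖ + ‖f z‖)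
      (fun n => ?_) (hi.norm.add hi.norm) (fun n => Eventually.of_forall fun z =>
        (norm_exp_mul_I_sub_one_le _).trans (hgb n z)) (Eventually.of_forall fun z => ?_)
    · have := (g n).measurable
      exact (by fun_prop : Measurable fun z => cexp (g n z * I) - 1).aestronglyMeasurable
    · exact ((by fun_prop : Continuous fun x : ℝ => cexp (x * I) - 1).tendsto _).comp (hgf z)
  refine tendsto_nhds_unique hl (hr.congr fun n => ?_)
  exact (hη.integral_exp_simpleFunc (g n) (hgi n)).symm

end Poisson

/-! ### Integrals against `ds dx / x` and the limiting pair. -/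

section Intensity

variable {E : Type*} [NormedAddCommGroup E] [NormedSpace ℝ E]

theorem measurableSet_unitSquare : MeasurableSet unitSquare :=
  measurableSet_Ioc.prod measurableSet_Ioc

theorem volume_restrict_unitSquare : (volume : Measure (ℝ × ℝ)).restrict unitSquare
    = (volume.restrict (Set.Ioc (0 : ℝ) 1)).prod (volume.restrict (Set.Ioc (0 : ℝ) 1)) := by
  rw [unitSquare, Measure.prod_restrict, Measure.volume_eq_prod]

theorem ae_mem_unitSquare_dickmanIntensity : ∀ᵐ z ∂dickmanIntensity, z ∈ unitSquare :=
  (withDensity_absolutelyContinuous _ _).ae_le (ae_restrict_mem measurableSet_unitSquare)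

theorem toReal_ofReal_one_div_ae (h : ℝ → E) :
    (fun z : ℝ × ℝ => (ENNReal.ofReal (1 / z.2)).toReal • h z.2)
      =ᵐ[volume.restrict unitSquare] fun z => (1 / z.2) • h z.2 := by
  filter_upwards [ae_restrict_mem measurableSet_unitSquare] with z hz
  rw [ENNReal.toReal_ofReal (by have := hz.2.1; positivity)]

theorem integrable_dickmanIntensity {h : ℝ → E}
    (hi : IntegrableOn (fun x => (1 / x) • h x) (Set.Ioc 0 1)) :
    Integrable (unitSquare.indicator fun z => h z.2) dickmanIntensity := by
  have h0 : Integrable (fun z : ℝ × ℝ => h z.2) dickmanIntensity := by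
    rw [dickmanIntensity, integrable_withDensity_iff_integrable_smul' (by fun_prop) (by simp),
      integrable_congr (toReal_ofReal_one_div_ae h), volume_restrict_unitSquare]
    exact hi.comp_snd _
  exact h0.indicator measurableSet_unitSquare

theorem integral_dickmanIntensity [CompleteSpace E] (h : ℝ → E) :
    ∫ z, unitSquare.indicator (fun z => h z.2) z ∂dickmanIntensity
      = ∫ x in Set.Ioc 0 1, (1 / x) • h x := by
  have h1 : ∫ z, unitSquare.indicator (fun z => h z.2) z ∂dickmanIntensity
      = ∫ z, h z.2 ∂dickmanIntensity := by
    refine integral_congr_ae ?_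
    filter_upwards [ae_mem_unitSquare_dickmanIntensity] with z hz
    rw [Set.indicator_of_mem hz]
  rw [h1, dickmanIntensity, integral_withDensity_eq_integral_toReal_smul (by fun_prop) (by simp),
    integral_congr_ae (toReal_ofReal_one_div_ae h), volume_restrict_unitSquare,
    integral_fun_snd (fun x : ℝ => (1 / x) • h x)]
  simp

theorem integrableOn_one_div_mul_rpow {α : ℝ} (hα : 0 < α) :
    IntegrableOn (fun x : ℝ => (1 / x) • x ^ α) (Set.Ioc 0 1) := by
  have h := (intervalIntegral.intervalIntegrable_rpow' (a := 0) (b := 1) (r := α - 1)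
    (by linarith)).1
  refine h.congr_fun (fun x hx => ?_) measurableSet_Ioc
  simp only [smul_eq_mul]
  rw [Real.rpow_sub_one hx.1.ne']
  ring

theorem integrableOn_one_div_mul_self :
    IntegrableOn (fun x : ℝ => (1 / x) • x) (Set.Ioc 0 1) := by
  simpa using integrableOn_one_div_mul_rpow one_pos

variable {Ω : Type*} [MeasurableSpace Ω] {P : Measure Ω}
  {η : Ω → Measure (ℝ × ℝ)}

open Complex in
/-- The joint characteristic function of `∫ x ^ α dη` and `∫ x dη`. -/
theorem IsPoissonRandomMeasure.charFun_dickman [IsProbabilityMeasure P]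
    (hη : IsPoissonRandomMeasure η dickmanIntensity P) {α : ℝ} (hα : 0 < α) (s t : ℝ) :
    ∫ ω, cexp (((s * ∫ z in unitSquare, z.2 ^ α ∂(η ω)) + t * ∫ z in unitSquare, z.2 ∂(η ω) : ℝ)
        * I) ∂P
      = cexp (∫ x in Set.Ioc (0 : ℝ) 1, (1 / x) • (cexp ((s * x ^ α + t * x : ℝ) * I) - 1)) := by
  have i1 := integrable_dickmanIntensity (integrableOn_one_div_mul_rpow hα)
  have i2 := integrable_dickmanIntensity integrableOn_one_div_mul_self
  have m1 : Measurable (unitSquare.indicator fun z : ℝ × ℝ => z.2 ^ α) :=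
    (by fun_prop : Measurable fun z : ℝ × ℝ => z.2 ^ α).indicator measurableSet_unitSquare
  have m2 : Measurable (unitSquare.indicator fun z : ℝ × ℝ => z.2) :=
    measurable_snd.indicator measurableSet_unitSquare
  have key := hη.integral_exp ((m1.const_mul s).add (m2.const_mul t))
    ((i1.const_mul s).add (i2.const_mul t))
  have hl : ∫ ω, cexp (((s * ∫ z in unitSquare, z.2 ^ α ∂(η ω))
      + t * ∫ z in unitSquare, z.2 ∂(η ω) : ℝ) * I) ∂P
      = ∫ ω, cexp ((∫ z, (s * unitSquare.indicator (fun z : ℝ × ℝ => z.2 ^ α) z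
        + t * unitSquare.indicator (fun z : ℝ × ℝ => z.2) z) ∂(η ω) : ℝ) * I) ∂P := by
    refine integral_congr_ae ?_
    filter_upwards [hη.ae_integrable m1 i1, hη.ae_integrable m2 i2] with ω h1 h2
    rw [integral_add (h1.const_mul s) (h2.const_mul t), integral_const_mul, integral_const_mul,
      integral_indicator measurableSet_unitSquare, integral_indicator measurableSet_unitSquare]
  rw [hl]
  refine key.trans ?_
  rw [← integral_dickmanIntensity]
  congr 2
  ext z
  by_cases hz : z ∈ unitSquare <;> simp [hz]

theorem IsPoissonRandomMeasure.ae_integrableOn_rpow [IsProbabilityMeasure P]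
    (hη : IsPoissonRandomMeasure η dickmanIntensity P) {α : ℝ} (hα : 0 < α) :
    ∀ᵐ ω ∂P, IntegrableOn (fun z : ℝ × ℝ => z.2 ^ α) unitSquare (η ω) := by
  have i1 := integrable_dickmanIntensity (integrableOn_one_div_mul_rpow hα)
  have m1 : Measurable (unitSquare.indicator fun z : ℝ × ℝ => z.2 ^ α) :=
    (by fun_prop : Measurable fun z : ℝ × ℝ => z.2 ^ α).indicator measurableSet_unitSquare
  filter_upwards [hη.ae_integrable m1 i1] with ω hω
  exact (integrable_indicator_iff measurableSet_unitSquare).1 hω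

theorem IsPoissonRandomMeasure.measurable_setIntegral_rpow
    (hη : IsPoissonRandomMeasure η dickmanIntensity P) (α : ℝ) :
    Measurable fun ω => ∫ z in unitSquare, z.2 ^ α ∂(η ω) := by
  simp_rw [← integral_indicator measurableSet_unitSquare]
  exact hη.measurable_integral_of_nonneg
    ((by fun_prop : Measurable fun z : ℝ × ℝ => z.2 ^ α).indicator measurableSet_unitSquare)
    fun z => Set.indicator_nonneg (fun z hz => Real.rpow_nonneg hz.2.1.le _) z

/-- The mean of `∫ x dη` is `∫₀¹ x dx / x = 1`, and a random variable does not exceed its mean with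
positive probability. -/
theorem IsPoissonRandomMeasure.measure_setIntegral_le_one_pos [IsProbabilityMeasure P]
    (hη : IsPoissonRandomMeasure η dickmanIntensity P) :
    0 < P {ω | ∫ z in unitSquare, z.2 ∂(η ω) ≤ 1} := by
  have i2 := integrable_dickmanIntensity integrableOn_one_div_mul_self
  have m2 : Measurable (unitSquare.indicator fun z : ℝ × ℝ => z.2) :=
    measurable_snd.indicator measurableSet_unitSquare
  have h := hη.integral_integral_of_nonneg m2 i2
    fun z => Set.indicator_nonneg (fun z hz => hz.2.1.le) z
  have h1 : ∫ x in Set.Ioc (0 : ℝ) 1, (1 / x) • x = 1 := by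
    rw [setIntegral_congr_fun (g := fun _ => (1 : ℝ)) measurableSet_Ioc fun x hx => by
      simp [hx.1.ne']]
    simp
  rw [integral_dickmanIntensity (fun x : ℝ => x), h1] at h
  simp_rw [integral_indicator measurableSet_unitSquare] at h
  have := measure_le_integral_pos h.1
  rwa [h.2] at this

end Intensity

/-! ### Mertens' first theorem, from the prime factorisation of `n!`. -/

section Mertens

theorem log_factorial_eq_sum (n : ℕ) :
    Real.log n.factorial
      = ∑ p ∈ Nat.primesLE n, (n.factorial.factorization p : ℝ) * Real.log p := by
  have h := Nat.prod_factorization_pow_eq_self n.factorial_ne_zero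
  conv_lhs => rw [← h]
  rw [Finsupp.prod, Nat.cast_prod, Real.log_prod]
  · simp_rw [Nat.cast_pow, Real.log_pow]
    refine Finset.sum_subset (fun p hp => ?_) fun p _ hp => ?_
    · rw [Nat.support_factorization, Nat.mem_primeFactors] at hp
      exact Nat.mem_primesLE.2 ⟨(hp.1.dvd_factorial).1 hp.2.1, hp.1⟩
    · rw [Finsupp.notMem_support_iff.1 hp]
      simp
  · intro p hp
    rw [Nat.support_factorization, Nat.mem_primeFactors] at hp
    have := hp.1.pos
    positivity

/-- Only the first term of Legendre's formula is kept. -/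
theorem le_factorization_factorial {p : ℕ} (hp : p.Prime) (n : ℕ) :
    (n : ℝ) / p - 1 ≤ n.factorial.factorization p := by
  have h1 : n / p ≤ n.factorial.factorization p := by
    rw [Nat.factorization_factorial hp (b := Nat.log p n + 2) (by omega)]
    have := Finset.single_le_sum (f := fun i => n / p ^ i) (fun _ _ => Nat.zero_le _)
      (Finset.mem_Ico.2 ⟨le_refl 1, by omega⟩ : 1 ∈ Finset.Ico 1 (Nat.log p n + 2))
    simpa using this
  have h2 : ((n / p : ℕ) : ℝ) ≤ n.factorial.factorization p := by exact_mod_cast h1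
  have h3 : (n : ℝ) / p < (n / p : ℕ) + 1 := by
    have hp0 : (0 : ℝ) < p := by exact_mod_cast hp.pos
    rw [div_lt_iff₀ hp0]
    have := Nat.lt_div_mul_add hp.pos (a := n)
    have h4 : n < (n / p + 1) * p := by linarith
    exact_mod_cast h4
  linarith

theorem factorization_factorial_le {p : ℕ} (hp : p.Prime) (n : ℕ) :
    (n.factorial.factorization p : ℝ) ≤ n * (1 / p + 1 / (p * (p - 1))) := by
  have h1 : (n.factorial.factorization p : ℝ) ≤ (n / (p - 1) : ℕ) := by
    exact_mod_cast Nat.factorization_factorial_le_div_pred hp n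
  have h2 : (1 : ℝ) < p := by exact_mod_cast hp.one_lt
  have h3 : ((n / (p - 1) : ℕ) : ℝ) ≤ n / ((p - 1 : ℕ) : ℝ) := Nat.cast_div_le
  rw [Nat.cast_sub hp.one_le, Nat.cast_one] at h3
  refine (h1.trans h3).trans (le_of_eq ?_)
  have h4 : (p : ℝ) - 1 ≠ 0 := by linarith
  field_simp
  ring

/-- Since `log k ≤ 2 k^{1/2}`, the terms are `O(k^{-3/2})`. The sum bounds the contribution of
higher prime powers to `log n!`. -/
theorem summable_log_div_mul_sub_one :
    Summable fun k : ℕ => Real.log k * (1 / (k * ((k : ℝ) - 1))) := by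
  have hs : Summable fun k : ℕ => 4 * (1 / (k : ℝ) ^ (3 / 2 : ℝ)) :=
    (Real.summable_one_div_nat_rpow.2 (by norm_num)).mul_left 4
  refine Summable.of_norm_bounded_eventually_nat hs ?_
  filter_upwards [eventually_ge_atTop 2] with k hk
  have hk' : (2 : ℝ) ≤ k := by exact_mod_cast hk
  have hk0 : (0 : ℝ) < k := by linarith
  have hlog := Real.log_le_rpow_div hk0.le (by norm_num : (0 : ℝ) < 1 / 2)
  have hlog0 : 0 ≤ Real.log k := Real.log_nonneg (by linarith)
  have h1 : 1 / (k * ((k : ℝ) - 1)) ≤ 2 / (k : ℝ) ^ 2 := by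
    rw [div_le_div_iff₀ (by nlinarith) (by positivity)]
    nlinarith
  have h1' : 0 ≤ 1 / (k * ((k : ℝ) - 1)) := by
    have : 0 < (k : ℝ) - 1 := by linarith
    positivity
  rw [Real.norm_of_nonneg (mul_nonneg hlog0 h1')]
  have h2 : (k : ℝ) ^ 2 = k ^ (1 / 2 : ℝ) * k ^ (3 / 2 : ℝ) := by
    rw [← Real.rpow_add hk0]
    norm_num
  calc Real.log k * (1 / (k * ((k : ℝ) - 1)))
      ≤ ((k : ℝ) ^ (1 / 2 : ℝ) / (1 / 2)) * (2 / (k : ℝ) ^ 2) := by gcongr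
    _ = 4 * (1 / (k : ℝ) ^ (3 / 2 : ℝ)) := by
        rw [h2]
        have : (0 : ℝ) < (k : ℝ) ^ (1 / 2 : ℝ) := by positivity
        field_simp
        norm_num

/-- **First theorem of Mertens**. -/
theorem exists_abs_sum_log_div_sub_log_le :
    ∃ C : ℝ, ∀ n : ℕ, 1 ≤ n → |∑ p ∈ Nat.primesLE n, Real.log p / p - Real.log n| ≤ C := by
  set D := ∑' k : ℕ, Real.log k * (1 / (k * ((k : ℝ) - 1))) with hD
  refine ⟨max (Real.log 4) (1 + D), fun n hn => ?_⟩
  have hn0 : (0 : ℝ) < n := by exact_mod_cast hn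
  set S := ∑ p ∈ Nat.primesLE n, Real.log p / p with hS
  have hfac := log_factorial_eq_sum n
  have hlow : n * Real.log n - n ≤ Real.log n.factorial := by
    have h := Real.pow_div_factorial_le_exp _ hn0.le n
    have hf : (0 : ℝ) < n.factorial := by positivity
    have h2 := Real.log_le_log (by positivity) h
    rw [Real.log_exp, Real.log_div (by positivity) hf.ne', Real.log_pow] at h2
    linarith
  have hup : Real.log n.factorial ≤ n * Real.log n := by
    rw [← Real.log_pow]
    exact Real.log_le_log (by positivity) (by exact_mod_cast Nat.factorial_le_pow n)
  -- The loss of 1 in each exponent costs `∑ log p` over `p ≤ n` in total, which Chebyshev bounds by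
  -- `n log 4`.
  have h1 : n * S - Real.log 4 * n ≤ Real.log n.factorial := by
    have hth := Chebyshev.theta_le_log4_mul_x hn0.le
    rw [Chebyshev.theta_eq_sum_primesLE_log] at hth
    have : n * S - ∑ p ∈ Nat.primesLE n, Real.log p ≤ Real.log n.factorial := by
      rw [hfac, hS, Finset.mul_sum, ← Finset.sum_sub_distrib]
      refine Finset.sum_le_sum fun p hp => ?_
      have hp' := Nat.prime_of_mem_primesLE hp
      have := mul_le_mul_of_nonneg_right (le_factorization_factorial hp' n)
        (Real.log_natCast_nonneg p)
      refine le_trans (le_of_eq ?_) this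
      ring
    linarith
  have h2 : Real.log n.factorial ≤ n * S + n * D := by
    have hle : ∑ p ∈ Nat.primesLE n, Real.log p * (1 / (p * ((p : ℝ) - 1))) ≤ D := by
      refine summable_log_div_mul_sub_one.sum_le_tsum _ fun k _ => ?_
      rcases Nat.eq_zero_or_pos k with rfl | hk
      · simp
      · have : (1 : ℝ) ≤ k := by exact_mod_cast hk
        have h' : 0 ≤ (k : ℝ) - 1 := by linarith
        have := Real.log_nonneg this
        positivity
    calc Real.log n.factorial
        ≤ ∑ p ∈ Nat.primesLE n, (n * (Real.log p / p)
            + n * (Real.log p * (1 / (p * ((p : ℝ) - 1))))) := by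
          rw [hfac]
          refine Finset.sum_le_sum fun p hp => ?_
          have hp' := Nat.prime_of_mem_primesLE hp
          have := mul_le_mul_of_nonneg_right (factorization_factorial_le hp' n)
            (Real.log_natCast_nonneg p)
          refine this.trans (le_of_eq ?_)
          ring
      _ = n * S + n * ∑ p ∈ Nat.primesLE n, Real.log p * (1 / (p * ((p : ℝ) - 1))) := by
          rw [Finset.sum_add_distrib, hS, Finset.mul_sum, Finset.mul_sum]
      _ ≤ n * S + n * D := by gcongr
  rw [abs_le]
  constructor
  · have : n * (Real.log n - 1) ≤ n * (S + D) := by linarith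
    have := le_of_mul_le_mul_left this hn0
    have := le_max_right (Real.log 4) (1 + D)
    linarith
  · have : n * S ≤ n * (Real.log n + Real.log 4) := by linarith
    have := le_of_mul_le_mul_left this hn0
    have := le_max_left (Real.log 4) (1 + D)
    linarith

/-- The primes `p` with `log p ≤ y`. -/
noncomputable def primesLogLE (y : ℝ) : Finset ℕ := Nat.primesLE ⌊Real.exp y⌋₊

theorem mem_primesLogLE {y : ℝ} {p : ℕ} : p ∈ primesLogLE y ↔ p.Prime ∧ Real.log p ≤ y := by
  rw [primesLogLE, Nat.mem_primesLE, and_comm]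
  refine and_congr_right fun hp => ?_
  rw [Nat.le_floor_iff (Real.exp_pos y).le,
    ← Real.log_le_iff_le_exp (by exact_mod_cast hp.pos)]

theorem primesLogLE_log {n : ℕ} (hn : 1 ≤ n) : primesLogLE (Real.log n) = Nat.primesLE n := by
  rw [primesLogLE, Real.exp_log (by exact_mod_cast hn), Nat.floor_natCast]

theorem primesLogLE_mono : Monotone primesLogLE := fun _ _ h _ hp =>
  mem_primesLogLE.2 ⟨(mem_primesLogLE.1 hp).1, (mem_primesLogLE.1 hp).2.trans h⟩

/-- The sum of `log p / p` over the primes with `log p ≤ y`. -/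
noncomputable def mertensSum (y : ℝ) : ℝ := ∑ p ∈ primesLogLE y, Real.log p / p

theorem log_prime_pos {p : ℕ} (hp : p.Prime) : 0 < Real.log p :=
  Real.log_pos (by exact_mod_cast hp.one_lt)

theorem mertensSum_nonneg (y : ℝ) : 0 ≤ mertensSum y :=
  Finset.sum_nonneg fun p _ => div_nonneg (Real.log_natCast_nonneg p) (Nat.cast_nonneg p)

/-- Replacing `e^y` by its integer part changes the logarithm by at most `log 2`. -/
theorem exists_abs_mertensSum_sub_le : ∃ C : ℝ, ∀ y : ℝ, 0 ≤ y → |mertensSum y - y| ≤ C := by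
  obtain ⟨C, hC⟩ := exists_abs_sum_log_div_sub_log_le
  refine ⟨C + Real.log 2, fun y hy => ?_⟩
  have he : 1 ≤ Real.exp y := Real.one_le_exp hy
  set n := ⌊Real.exp y⌋₊ with hn
  have hn1 : 1 ≤ n := Nat.one_le_floor_iff _ |>.2 he
  have hn1' : (1 : ℝ) ≤ n := by exact_mod_cast hn1
  have h1 : (n : ℝ) ≤ Real.exp y := Nat.floor_le (by positivity)
  have h2 : Real.exp y < n + 1 := Nat.lt_floor_add_one _
  have h3 : Real.log n ≤ y := (Real.log_le_iff_le_exp (by linarith)).2 h1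
  have h4 : y ≤ Real.log n + Real.log 2 := by
    rw [← Real.log_mul (by linarith) (by norm_num), Real.le_log_iff_exp_le (by linarith)]
    linarith
  have h5 := abs_le.1 (hC n hn1)
  have hl := Real.log_pos (by norm_num : (1 : ℝ) < 2)
  rw [mertensSum, primesLogLE, ← hn, abs_le]
  constructor <;> linarith

theorem tendsto_mertensSum_div : Tendsto (fun y => mertensSum y / y) atTop (𝓝 1) := by
  obtain ⟨C, hC⟩ := exists_abs_mertensSum_sub_le
  rw [← tendsto_sub_nhds_zero_iff]
  refine squeeze_zero_norm' ?_ (tendsto_const_nhds.div_atTop tendsto_id : Tendsto (fun y => C / y)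
    atTop (𝓝 0))
  filter_upwards [eventually_gt_atTop 0] with y hy
  rw [Real.norm_eq_abs, show mertensSum y / y - 1 = (mertensSum y - y) / y by field_simp, abs_div,
    abs_of_pos hy]
  gcongr
  exact hC y hy.le

theorem tendsto_mertensSum_mul_div {x : ℝ} (hx : 0 ≤ x) :
    Tendsto (fun y => mertensSum (x * y) / y) atTop (𝓝 x) := by
  rcases hx.eq_or_lt with rfl | hx
  · simp only [zero_mul]
    exact tendsto_const_nhds.div_atTop tendsto_id
  · have h := (tendsto_mertensSum_div.comp (tendsto_id.const_mul_atTop hx)).const_mul x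
    rw [mul_one] at h
    refine h.congr' ?_
    filter_upwards [eventually_gt_atTop 0] with y hy
    simp only [Function.comp_apply, id_eq]
    field_simp

end Mertens

/-! ### Equidistribution of `log p / y` with weights `log p / p`. -/

section Equidistribution

/-- Differences of distribution functions give the masses of half-open intervals, a π-system
containing small neighbourhoods of each point. -/
theorem tendsto_probabilityMeasure_of_tendsto_Iic {ι : Type*} {l : Filter ι}
    [l.IsCountablyGenerated] {μ : ι → ProbabilityMeasure ℝ} {ν : ProbabilityMeasure ℝ}
    (h : ∀ x, Tendsto (fun i => (μ i : Measure ℝ).real (Set.Iic x)) l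
      (𝓝 ((ν : Measure ℝ).real (Set.Iic x)))) : Tendsto μ l (𝓝 ν) := by
  have hd : ∀ (m : ProbabilityMeasure ℝ) {a b : ℝ}, a < b → (m : Measure ℝ).real (Set.Ioc a b)
      = (m : Measure ℝ).real (Set.Iic b) - (m : Measure ℝ).real (Set.Iic a) := by
    intro m a b hab
    rw [← Set.Iic_sdiff_Iic, measureReal_sdiff (Set.Iic_subset_Iic.2 hab.le) measurableSet_Iic]
  refine (isPiSystem_Ioc (id : ℝ → ℝ) id).tendsto_probabilityMeasure_of_tendsto_of_mem ?_ ?_ ?_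
  · rintro _ ⟨a, b, -, rfl⟩
    exact measurableSet_Ioc
  · intro u hu x hx
    obtain ⟨ε, hε, hball⟩ := Metric.isOpen_iff.1 hu x hx
    refine ⟨Set.Ioc (x - ε / 2) (x + ε / 2), ⟨_, _, by simp only [id]; linarith, rfl⟩,
      Ioc_mem_nhds (by linarith) (by linarith), fun z hz => hball ?_⟩
    rw [Metric.mem_ball, Real.dist_eq, abs_lt]
    constructor <;> linarith [hz.1, hz.2]
  · rintro _ ⟨a, b, hab, rfl⟩
    change a < b at hab
    have := (h b).sub (h a)
    rw [← hd ν hab] at this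
    rw [← NNReal.tendsto_coe]
    exact this.congr fun i => (hd (μ i) hab).symm

/-- The law proportional to `δ_0 + ∑ (log p / p) δ_{log p / y}`; the atom at `0` keeps the total mass
positive. -/
noncomputable def mertensMeasure (y : ℝ) : Measure ℝ :=
  ENNReal.ofReal (1 / (1 + mertensSum y)) • (Measure.dirac 0
    + ∑ p ∈ primesLogLE y, ENNReal.ofReal (Real.log p / p) • Measure.dirac (Real.log p / y))

theorem integral_mertensMeasure {E : Type*} [NormedAddCommGroup E] [NormedSpace ℝ E]
    [CompleteSpace E] (y : ℝ) (k : ℝ → E) :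
    ∫ x, k x ∂(mertensMeasure y) = (1 / (1 + mertensSum y)) •
      (k 0 + ∑ p ∈ primesLogLE y, (Real.log p / p) • k (Real.log p / y)) := by
  have h0 : ∀ p : ℕ, 0 ≤ Real.log p / p := fun p =>
    div_nonneg (Real.log_natCast_nonneg p) (Nat.cast_nonneg p)
  have hi : ∀ a, Integrable k (Measure.dirac a) := fun a => integrable_dirac (by simp)
  have hi' : ∀ p ∈ primesLogLE y, Integrable k
      (ENNReal.ofReal (Real.log p / p) • Measure.dirac (Real.log p / y)) := fun p _ =>
    (hi _).smul_measure ENNReal.ofReal_ne_top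
  rw [mertensMeasure, integral_smul_measure, integral_add_measure (hi 0)
    (integrable_finsetSum_measure.2 hi'), integral_finsetSum_measure hi',
    ENNReal.toReal_ofReal (one_div_nonneg.2 (by linarith [mertensSum_nonneg y]))]
  simp only [integral_smul_measure, integral_dirac, ENNReal.toReal_ofReal (h0 _)]

instance isProbabilityMeasure_mertensMeasure (y : ℝ) :
    IsProbabilityMeasure (mertensMeasure y) := by
  constructor
  have h : 0 < 1 + mertensSum y := by linarith [mertensSum_nonneg y]
  have h0 : ∀ p ∈ primesLogLE y, 0 ≤ Real.log p / p := fun p _ =>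
    div_nonneg (Real.log_natCast_nonneg p) (Nat.cast_nonneg p)
  rw [mertensMeasure, Measure.smul_apply, Measure.add_apply, Measure.finsetSum_apply]
  simp only [Measure.smul_apply, measure_univ, smul_eq_mul, mul_one]
  rw [← ENNReal.ofReal_sum_of_nonneg h0, ← mertensSum, ← ENNReal.ofReal_one, ← ENNReal.ofReal_add zero_le_one
    (mertensSum_nonneg y), ← ENNReal.ofReal_mul (by positivity)]
  congr 1
  field_simp

theorem mertensMeasure_real_Iic {y : ℝ} (hy : 0 < y) {x : ℝ} (hx : 0 ≤ x) :
    (mertensMeasure y).real (Set.Iic x)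
      = (1 + mertensSum (min x 1 * y)) / (1 + mertensSum y) := by
  have h := integral_mertensMeasure y ((Set.Iic x).indicator fun _ => (1 : ℝ))
  rw [integral_indicator measurableSet_Iic, setIntegral_const, smul_eq_mul, mul_one] at h
  have hs : ∑ p ∈ primesLogLE y, (Real.log p / p) •
      (Set.Iic x).indicator (fun _ => (1 : ℝ)) (Real.log p / y) = mertensSum (min x 1 * y) := by
    have hsub : primesLogLE (min x 1 * y) = (primesLogLE y).filter fun p : ℕ => Real.log p / y ≤ x := by
      ext p
      rw [Finset.mem_filter, mem_primesLogLE, mem_primesLogLE, and_assoc, div_le_iff₀ hy,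
        min_mul_of_nonneg _ _ hy.le, le_min_iff, one_mul, and_comm (a := _ ≤ x * y)]
    rw [mertensSum, hsub, Finset.sum_filter]
    refine Finset.sum_congr rfl fun p _ => ?_
    by_cases hp : Real.log p / y ≤ x <;> simp [Set.indicator, hp]
  rw [h, hs, Set.indicator_of_mem (Set.mem_Iic.2 hx), smul_eq_mul]
  ring

theorem mertensMeasure_real_Iic_of_neg {y : ℝ} (hy : 0 < y) {x : ℝ} (hx : x < 0) :
    (mertensMeasure y).real (Set.Iic x) = 0 := by
  have h := integral_mertensMeasure y ((Set.Iic x).indicator fun _ => (1 : ℝ))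
  rw [integral_indicator measurableSet_Iic, setIntegral_const, smul_eq_mul, mul_one] at h
  rw [h, Set.indicator_of_notMem (by simpa using hx), Finset.sum_eq_zero, add_zero, smul_zero]
  intro p _
  have : 0 ≤ Real.log p / y := div_nonneg (Real.log_natCast_nonneg p) hy.le
  rw [Set.indicator_of_notMem (by simpa using hx.trans_le this), smul_zero]

/-- The measures `y⁻¹ ∑ (log p / p) δ_{log p / y}` converge weakly to the uniform law. -/
theorem tendsto_sum_log_div_mul {k : ℝ → ℂ} (hk : Continuous k) {C : ℝ} (hC : ∀ x, ‖k x‖ ≤ C) :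
    Tendsto (fun y : ℝ => (1 / y) • ∑ p ∈ primesLogLE y, (Real.log p / p) • k (Real.log p / y))
      atTop (𝓝 (∫ x in Set.Ioc (0 : ℝ) 1, k x)) := by
  have hU : IsProbabilityMeasure (volume.restrict (Set.Ioc (0 : ℝ) 1)) := ⟨by simp⟩
  have hw : Tendsto (β := ProbabilityMeasure ℝ) (fun y => ⟨mertensMeasure y, inferInstance⟩) atTop
      (𝓝 ⟨volume.restrict (Set.Ioc (0 : ℝ) 1), hU⟩) := by
    -- For `x ≥ 0` the distribution function is `(1 + M(min x 1 * y)) / (1 + M(y))` with `M =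
    -- mertensSum`, which tends to `min x 1` by Mertens.
    refine tendsto_probabilityMeasure_of_tendsto_Iic fun x => ?_
    simp only [ProbabilityMeasure.coe_mk]
    rcases lt_or_ge x 0 with hx | hx
    · have h1 : (volume.restrict (Set.Ioc (0 : ℝ) 1)).real (Set.Iic x) = 0 := by
        rw [measureReal_restrict_apply measurableSet_Iic, Set.Iic_inter_Ioc_of_le (by linarith),
          Set.Ioc_eq_empty (by linarith), measureReal_empty]
      rw [h1]
      refine tendsto_const_nhds.congr' ?_
      filter_upwards [eventually_gt_atTop 0] with y hy
      exact (mertensMeasure_real_Iic_of_neg hy hx).symm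
    · have h1 : (volume.restrict (Set.Ioc (0 : ℝ) 1)).real (Set.Iic x) = min x 1 := by
        rw [measureReal_restrict_apply measurableSet_Iic, Set.inter_comm, Set.Ioc_inter_Iic,
          Real.volume_real_Ioc_of_le (by positivity), sub_zero, min_comm]
      have h2 : ∀ {z : ℝ}, 0 ≤ z →
          Tendsto (fun y : ℝ => (1 + mertensSum (z * y)) / y) atTop (𝓝 z) := by
        intro z hz
        have := (tendsto_const_nhds (x := (1 : ℝ)).div_atTop tendsto_id).add
          (tendsto_mertensSum_mul_div hz)
        rw [zero_add] at this
        exact this.congr fun y => by simp [add_div]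
      have h3 := (h2 (le_min hx zero_le_one)).div (h2 zero_le_one) one_ne_zero
      rw [h1]
      rw [div_one] at h3
      refine h3.congr' ?_
      filter_upwards [eventually_gt_atTop 0] with y hy
      rw [mertensMeasure_real_Iic hy hx, Pi.div_apply, one_mul, div_div_div_cancel_right₀ hy.ne']
  have h1 := (ProbabilityMeasure.tendsto_iff_forall_integral_rclike_tendsto ℂ).1 hw
    (BoundedContinuousFunction.ofNormedAddCommGroup k hk C hC)
  simp only [ProbabilityMeasure.coe_mk, BoundedContinuousFunction.coe_ofNormedAddCommGroup,
    integral_mertensMeasure] at h1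
  have h2 : Tendsto (fun y : ℝ => (1 + mertensSum y) / y) atTop (𝓝 1) := by
    have := (tendsto_const_nhds (x := (1 : ℝ)).div_atTop tendsto_id).add tendsto_mertensSum_div
    rw [zero_add] at this
    exact this.congr fun y => by simp [add_div]
  have h3 : Tendsto (fun y : ℝ => (1 / y) • k 0) atTop (𝓝 0) := by
    have := (tendsto_const_nhds (x := (1 : ℝ)).div_atTop tendsto_id).smul_const (k 0)
    rwa [zero_smul] at this
  -- Change the normalisation from `1 + mertensSum y` to `y` and remove the auxiliary atom at 0, now
  -- of vanishing weight.
  have h4 := (h2.smul h1).sub h3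
  rw [one_smul, sub_zero] at h4
  refine h4.congr fun y => ?_
  have : 1 + mertensSum y ≠ 0 := by linarith [mertensSum_nonneg y]
  rw [smul_smul, show (1 + mertensSum y) / y * (1 / (1 + mertensSum y)) = 1 / y by field_simp,
    smul_add, add_sub_cancel_left]

end Equidistribution

/-! ### Regular variation of monotone functions. -/

section RegularVariation

/-- `θ` is regularly varying of index `α`, and eventually positive and increasing. -/
structure RegularlyGrowing (θ : ℝ → ℝ) (α : ℝ) : Prop where
  tendsto : ∀ t, 0 < t → Tendsto (fun x => θ (t * x) / θ x) atTop (𝓝 (t ^ α))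
  eventually : ∃ A : ℝ, 0 < A ∧ (∀ x, A ≤ x → 0 < θ x) ∧ MonotoneOn θ (Set.Ici A)

theorem IsDegree.tendsto_mul {θ : ℝ → ℝ} {α : ℝ} (h : IsDegree θ α) {t : ℝ} (ht : 0 < t) :
    Tendsto (fun x => θ (t * x) / θ x) atTop (𝓝 (t ^ α)) := by
  have h1 := (h.2 t ht).mul_const (t ^ α)
  rw [one_mul] at h1
  refine h1.congr' ?_
  filter_upwards [eventually_gt_atTop 0] with x hx
  have hx' : x ^ α ≠ 0 := (Real.rpow_pos_of_pos hx α).ne'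
  have h2 : t ^ α ≠ 0 := (Real.rpow_pos_of_pos ht α).ne'
  rw [Real.mul_rpow ht.le hx.le]
  by_cases h0 : θ x = 0
  · simp [h0]
  · field_simp

/-- Monotonicity forces eventual positivity: where `θ x ≤ 0`, the inequality `θ x ≤ θ (2 x)` gives
`θ (2 x) / θ x ≤ 1`, against the limit `2 ^ α > 1`. -/
theorem regularlyGrowing_of_monotoneOn {θ : ℝ → ℝ} {α a : ℝ} (hα : 0 < α)
    (h : ∀ t, 0 < t → Tendsto (fun x => θ (t * x) / θ x) atTop (𝓝 (t ^ α)))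
    (hm : MonotoneOn θ (Set.Ici a)) : RegularlyGrowing θ α := by
  refine ⟨h, ?_⟩
  have h2 : (1 : ℝ) < 2 ^ α := Real.one_lt_rpow (by norm_num) hα
  obtain ⟨B, hB⟩ := eventually_atTop.1 ((h 2 (by norm_num)).eventually (lt_mem_nhds h2))
  refine ⟨max (max a B) 1, by positivity, fun x hx => ?_,
    hm.mono (Set.Ici_subset_Ici.2 ((le_max_left a B).trans (le_max_left _ _)))⟩
  have hxa : a ≤ x := (le_max_left a B).trans ((le_max_left _ _).trans hx)
  have hxB : B ≤ x := (le_max_right a B).trans ((le_max_left _ _).trans hx)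
  have hx1 : 1 ≤ x := (le_max_right _ _).trans hx
  have h3 := hB x hxB
  have h4 : θ x ≤ θ (2 * x) := hm hxa (show a ≤ 2 * x by linarith) (by linarith)
  by_contra! h5
  rcases h5.eq_or_lt with h6 | h6
  · rw [h6, div_zero] at h3
    linarith
  · have := div_le_one_of_ge h4 h6.le
    linarith

theorem RegularlyGrowing.tendsto_atTop {θ : ℝ → ℝ} {α : ℝ} (h : RegularlyGrowing θ α)
    (hα : 0 < α) : Tendsto θ atTop atTop := by
  obtain ⟨A, hA, hpos, hm⟩ := h.eventually
  have hm' : Monotone fun x => θ (max x A) := fun x y hxy =>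
    hm (Set.mem_Ici.2 (le_max_right _ _)) (Set.mem_Ici.2 (le_max_right _ _)) (max_le_max_right A hxy)
  have he : (fun x => θ (max x A)) =ᶠ[atTop] θ := by
    filter_upwards [eventually_ge_atTop A] with x hx
    rw [max_eq_left hx]
  rcases tendsto_atTop_of_monotone hm' with h1 | ⟨l, h1⟩
  · exact h1.congr' he
  · exfalso
    replace h1 := h1.congr' he
    have hl : θ A ≤ l := ge_of_tendsto h1 (by
      filter_upwards [eventually_ge_atTop A] with x hx
      exact hm (le_refl A) hx hx)
    have hl0 : l ≠ 0 := (lt_of_lt_of_le (hpos A le_rfl) hl).ne'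
    have h2 := (h1.comp (tendsto_id.const_mul_atTop (by norm_num : (0 : ℝ) < 2))).div h1 hl0
    rw [div_self hl0] at h2
    have h3 := tendsto_nhds_unique h2 (h.tendsto 2 (by norm_num))
    have h4 : (1 : ℝ) < 2 ^ α := Real.one_lt_rpow (by norm_num) hα
    linarith

theorem regularlyGrowing_rpow {α : ℝ} (hα : 0 ≤ α) : RegularlyGrowing (fun x => x ^ α) α := by
  refine ⟨fun t ht => ?_, 1, one_pos, fun x hx => Real.rpow_pos_of_pos (by linarith) α,
    fun x hx y _ hxy => Real.rpow_le_rpow (zero_le_one.trans hx) hxy hα⟩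
  refine tendsto_const_nhds.congr' ?_
  filter_upwards [eventually_gt_atTop 0] with x hx
  rw [Real.mul_rpow ht.le hx.le, mul_div_assoc, div_self (Real.rpow_pos_of_pos hx α).ne', mul_one]

/-- On the range of summation `1 / p ≤ log p / (p ε y)`. -/
theorem sum_one_div_primes_le {ε y : ℝ} (hε : 0 < ε) (hy : 0 < y) :
    ∑ p ∈ primesLogLE y with ε * y < Real.log (p : ℕ), 1 / (p : ℝ) ≤ mertensSum y / y / ε := by
  calc ∑ p ∈ primesLogLE y with ε * y < Real.log (p : ℕ), 1 / (p : ℝ)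
      ≤ ∑ p ∈ primesLogLE y with ε * y < Real.log (p : ℕ), Real.log p / p / (y * ε) := by
        refine Finset.sum_le_sum fun p hp => ?_
        have hp' := (Finset.mem_filter.1 hp).2
        have : (0 : ℝ) < p := by
          exact_mod_cast (mem_primesLogLE.1 (Finset.mem_filter.1 hp).1).1.pos
        rw [div_div, div_le_div_iff₀ this (by positivity)]
        nlinarith
    _ ≤ ∑ p ∈ primesLogLE y, Real.log p / p / (y * ε) := by
        refine Finset.sum_le_sum_of_subset_of_nonneg (Finset.filter_subset _ _) fun p _ _ => ?_
        have := Real.log_natCast_nonneg p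
        positivity
    _ = mertensSum y / y / ε := by rw [← Finset.sum_div, mertensSum, div_div]

/-- A dyadic recursion: halving `y` costs `4 θ(y)`, while `θ(y / 2) ≤ q θ(y)` with a fixed `q < 1`,
so the costs add up geometrically. Applied at `ε y`, the bound makes the small primes negligible. -/
theorem RegularlyGrowing.exists_sum_le {θ : ℝ → ℝ} {α : ℝ} (h : RegularlyGrowing θ α)
    (hα : 0 < α) : ∃ K y₀ : ℝ, ∀ y, y₀ ≤ y →
      ∑ p ∈ primesLogLE y, |θ (Real.log p)| / p ≤ K * θ y := by
  obtain ⟨A, hA, hpos, hm⟩ := h.eventually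
  have hq1 : (1 / 2 : ℝ) ^ α < 1 := Real.rpow_lt_one (by norm_num) (by norm_num) hα
  obtain ⟨q, hq, hq'⟩ := exists_between hq1
  have e1 := (h.tendsto (1 / 2) (by norm_num)).eventually (gt_mem_nhds hq)
  have e2 := tendsto_mertensSum_div.eventually (gt_mem_nhds (by norm_num : (1 : ℝ) < 2))
  obtain ⟨B, hB⟩ := eventually_atTop.1 (e1.and e2)
  set y₁ := max A B with hy₁
  have hA1 : A ≤ y₁ := le_max_left _ _
  have hB1 : B ≤ y₁ := le_max_right _ _
  set T : ℝ → ℝ := fun y => ∑ p ∈ primesLogLE y, |θ (Real.log p)| / p with hT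
  have hTm : Monotone T := fun y z hyz =>
    Finset.sum_le_sum_of_subset_of_nonneg (primesLogLE_mono hyz) fun p _ _ => by positivity
  -- The first entry covers the base range `[y₁, 2 y₁]`; the second ensures `K q + 4 ≤ K`, which
  -- closes the induction.
  set K := max (T (2 * y₁) / θ y₁) (4 / (1 - q)) with hK
  have hK0 : 0 ≤ K := le_max_of_le_right (div_nonneg (by norm_num) (by linarith))
  have hK1 : T (2 * y₁) ≤ K * θ y₁ := by
    rw [← div_le_iff₀ (hpos _ hA1)]
    exact le_max_left _ _
  have hK2 : 4 ≤ K * (1 - q) := by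
    rw [← div_le_iff₀ (by linarith)]
    exact le_max_right _ _
  have hrec : ∀ y, 2 * y₁ ≤ y → T y ≤ T (y / 2) + 4 * θ y := by
    intro y hy
    have hy0 : 0 < y := by linarith
    have hsplit : T y = T (y / 2)
        + ∑ p ∈ primesLogLE y with 1 / 2 * y < Real.log (p : ℕ), |θ (Real.log p)| / p := by
      have : primesLogLE (y / 2) = (primesLogLE y).filter fun p : ℕ => ¬ 1 / 2 * y < Real.log p := by
        ext p
        rw [Finset.mem_filter, mem_primesLogLE, mem_primesLogLE, not_lt, and_assoc]
        refine and_congr_right fun _ => ⟨fun h => ⟨by linarith, by linarith⟩, fun h => ?_⟩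
        linarith [h.2]
      simp only [hT]
      rw [this, add_comm, Finset.sum_filter_add_sum_filter_not]
    have h1 : ∑ p ∈ primesLogLE y with 1 / 2 * y < Real.log (p : ℕ), |θ (Real.log p)| / p
        ≤ ∑ p ∈ primesLogLE y with 1 / 2 * y < Real.log (p : ℕ), θ y * (1 / (p : ℝ)) := by
      refine Finset.sum_le_sum fun p hp => ?_
      rw [Finset.mem_filter, mem_primesLogLE] at hp
      have hlp : A ≤ Real.log p := by linarith [hp.2]
      rw [abs_of_pos (hpos _ hlp), div_eq_mul_one_div]
      gcongr
      exact hm hlp (show A ≤ y by linarith) hp.1.2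
    rw [← Finset.mul_sum] at h1
    have h2 := sum_one_div_primes_le (by norm_num : (0 : ℝ) < 1 / 2) hy0
    have h3 : mertensSum y / y / (1 / 2) ≤ 4 := by
      have := (hB y (by linarith)).2
      linarith
    have h4 := mul_le_mul_of_nonneg_left (h2.trans h3) (hpos y (by linarith)).le
    linarith
  have key : ∀ n : ℕ, ∀ y, y₁ ≤ y → y ≤ 2 ^ (n + 1) * y₁ → T y ≤ K * θ y := by
    intro n
    induction n with
    | zero =>
      intro y hy hy'
      rw [zero_add, pow_one] at hy'
      refine (hTm hy').trans (hK1.trans ?_)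
      exact mul_le_mul_of_nonneg_left (hm hA1 (hA1.trans hy) hy) hK0
    | succ n ih =>
      intro y hy hy'
      rcases le_or_gt (2 * y₁) y with h2 | h2
      · have h3 := ih (y / 2) (by linarith) (by rw [pow_succ] at hy'; linarith)
        have h4 : θ (y / 2) ≤ q * θ y := by
          have := (hB y (by linarith)).1
          rw [div_lt_iff₀ (hpos y (by linarith)), one_div_mul_eq_div] at this
          exact this.le
        have h5 := hrec y h2
        have h6 := mul_le_mul_of_nonneg_left h4 hK0
        have h7 := mul_le_mul_of_nonneg_right hK2 (hpos y (by linarith)).le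
        nlinarith
      · exact ih y hy (h2.le.trans (by
          have : (1 : ℝ) ≤ 2 ^ n := one_le_pow₀ (by norm_num)
          rw [pow_succ]
          nlinarith))
  refine ⟨K, y₁, fun y hy => ?_⟩
  have hy1 : 0 < y₁ := by linarith
  obtain ⟨n, hn⟩ := pow_unbounded_of_one_lt (y / y₁) (by norm_num : (1 : ℝ) < 2)
  refine key n y hy ?_
  rw [div_lt_iff₀ hy1] at hn
  rw [pow_succ]
  nlinarith

/-- Pointwise convergence of monotone functions to a continuous limit is locally uniform: values
near `x` are squeezed between those at two close points `a < x < b`. Compactness of `[ε, 1]` does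
the rest. -/
theorem RegularlyGrowing.eventually_abs_sub_le {θ : ℝ → ℝ} {α : ℝ} (h : RegularlyGrowing θ α)
    (hα : 0 ≤ α) {ε δ : ℝ} (hε : 0 < ε) (hδ : 0 < δ) :
    ∀ᶠ y in atTop, ∀ x ∈ Set.Icc ε 1, |θ (x * y) / θ y - x ^ α| < δ := by
  obtain ⟨A, hA, hpos, hm⟩ := h.eventually
  have hloc : TendstoLocallyUniformlyOn (fun y x => θ (x * y) / θ y) (fun x => x ^ α) atTop
      (Set.Icc ε 1) := by
    rw [Metric.tendstoLocallyUniformlyOn_iff]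
    intro r hr x hx
    have hx0 : 0 < x := hε.trans_le hx.1
    have hc : ContinuousAt (fun x : ℝ => x ^ α) x :=
      (Real.continuous_rpow_const hα).continuousAt
    obtain ⟨d, hd, hball⟩ := Metric.continuousAt_iff.1 hc (r / 4) (by linarith)
    -- The entry `x / 2` keeps `a` positive, so that `a * y` eventually enters the range of
    -- monotonicity.
    set a := max (x - d / 2) (x / 2) with ha
    set b := x + d / 2 with hb
    have ha0 : 0 < a := lt_max_of_lt_right (by linarith)
    have hax : a < x := max_lt (by linarith) (by linarith)
    have ha' := hball (x := a) (by
      rw [Real.dist_eq, abs_lt]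
      constructor <;> linarith [le_max_left (x - d / 2) (x / 2)])
    have hb' := hball (x := b) (by
      rw [Real.dist_eq, abs_lt]
      constructor <;> linarith)
    refine ⟨Set.Ioo a b, mem_nhdsWithin_of_mem_nhds (Ioo_mem_nhds hax (by linarith)), ?_⟩
    have ea := Metric.tendsto_nhds.1 (h.tendsto a ha0) (r / 4) (by linarith)
    have eb := Metric.tendsto_nhds.1 (h.tendsto b (by linarith)) (r / 4) (by linarith)
    filter_upwards [ea, eb, eventually_ge_atTop (A / a), eventually_ge_atTop A]
      with y h1 h2 h3 h4 z hz
    rw [div_le_iff₀ ha0] at h3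
    have hy : 0 < y := by linarith
    have hz' : z ^ α ∈ Set.Icc (a ^ α) (b ^ α) :=
      ⟨Real.rpow_le_rpow ha0.le hz.1.le hα, Real.rpow_le_rpow (ha0.trans hz.1).le hz.2.le hα⟩
    have k1 : a * y ≤ z * y := mul_le_mul_of_nonneg_right hz.1.le hy.le
    have k2 : z * y ≤ b * y := mul_le_mul_of_nonneg_right hz.2.le hy.le
    have k0 : A ≤ a * y := by linarith
    have m1 : θ (a * y) / θ y ≤ θ (z * y) / θ y :=
      div_le_div_of_nonneg_right (hm k0 (k0.trans k1) k1) (hpos y h4).le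
    have m2 : θ (z * y) / θ y ≤ θ (b * y) / θ y :=
      div_le_div_of_nonneg_right (hm (k0.trans k1) ((k0.trans k1).trans k2) k2) (hpos y h4).le
    rw [Real.dist_eq, abs_lt] at h1 h2 ha' hb' ⊢
    constructor <;> linarith [hz'.1, hz'.2]
  have hu := (tendstoLocallyUniformlyOn_iff_tendstoUniformlyOn_of_compact isCompact_Icc).1 hloc
  filter_upwards [Metric.tendstoUniformlyOn_iff.1 hu δ hδ] with y hy x hx
  have := hy x hx
  rwa [dist_comm, Real.dist_eq] at this

end RegularVariation

/-! ### The limit of the exponent, a sum over primes. -/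

section PrimeSum

open Complex

theorem norm_exp_mul_I_sub_exp_mul_I_le (x y : ℝ) :
    ‖cexp (x * I) - cexp (y * I)‖ ≤ |x - y| := by
  have h : cexp (x * I) - cexp (y * I) = cexp (y * I) * (cexp ((x - y : ℝ) * I) - 1) := by
    rw [mul_sub, ← Complex.exp_add, mul_one]
    push_cast
    ring_nf
  rw [h, norm_mul, Complex.norm_exp_ofReal_mul_I, one_mul]
  exact norm_exp_mul_I_sub_one_le _

/-- The integrand `exp (i (s x ^ α + t x)) - 1` in the exponent of the limiting characteristic
function. -/
noncomputable def limitPhase (α s t x : ℝ) : ℂ := cexp ((s * x ^ α + t * x : ℝ) * I) - 1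

theorem continuous_limitPhase {α : ℝ} (hα : 0 ≤ α) (s t : ℝ) :
    Continuous (limitPhase α s t) := by
  have := Real.continuous_rpow_const hα
  unfold limitPhase
  fun_prop

theorem norm_limitPhase_le (α s t x : ℝ) : ‖limitPhase α s t x‖ ≤ |s * x ^ α + t * x| :=
  norm_exp_mul_I_sub_one_le _

theorem norm_limitPhase_le_two (α s t x : ℝ) : ‖limitPhase α s t x‖ ≤ 2 := by
  refine (norm_sub_le _ _).trans ?_
  rw [Complex.norm_exp_ofReal_mul_I, norm_one]
  norm_num

theorem norm_limitPhase_le_add {α s t x : ℝ} (hx : 0 ≤ x) :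
    ‖limitPhase α s t x‖ ≤ |s| * x ^ α + |t| * x := by
  refine (norm_limitPhase_le α s t x).trans ((abs_add_le _ _).trans (le_of_eq ?_))
  rw [abs_mul, abs_mul, abs_of_nonneg hx, abs_of_nonneg (Real.rpow_nonneg hx α)]

/-- Truncating `1 / x` to `1 / max x ε` makes the integrand a bounded continuous test function; `|s|
x^{α-1} + |t|` dominates, so the truncation can be removed. -/
theorem tendsto_integral_limitPhase_div_max {α : ℝ} (hα : 0 < α) (s t : ℝ) :
    Tendsto (fun ε : ℝ => ∫ x in Set.Ioc (0 : ℝ) 1, (1 / max x ε) • limitPhase α s t x) (𝓝[>] 0)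
      (𝓝 (∫ x in Set.Ioc (0 : ℝ) 1, (1 / x) • limitPhase α s t x)) := by
  have hc := continuous_limitPhase hα.le s t
  refine tendsto_integral_filter_of_dominated_convergence
    (fun x => |s| * ((1 / x) • x ^ α) + |t| * ((1 / x) • x)) ?_ ?_
    (((integrableOn_one_div_mul_rpow hα).const_mul _).add
      (integrableOn_one_div_mul_self.const_mul _)) ?_
  · refine Eventually.of_forall fun ε => ?_
    exact (by fun_prop : Measurable fun x : ℝ => (1 / max x ε)).aestronglyMeasurable.smul
      hc.aestronglyMeasurable
  · filter_upwards [self_mem_nhdsWithin] with ε hε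
    refine (ae_restrict_iff' measurableSet_Ioc).2 (Eventually.of_forall fun x hx => ?_)
    have hx0 := hx.1
    rw [norm_smul, Real.norm_of_nonneg (by positivity)]
    calc 1 / max x ε * ‖limitPhase α s t x‖
        ≤ 1 / x * (|s| * x ^ α + |t| * x) := by
          gcongr
          · exact le_max_left _ _
          · exact norm_limitPhase_le_add hx0.le
      _ = |s| * ((1 / x) • x ^ α) + |t| * ((1 / x) • x) := by
          simp only [smul_eq_mul]
          ring
  · refine (ae_restrict_iff' measurableSet_Ioc).2 (Eventually.of_forall fun x hx => ?_)
    refine Tendsto.smul_const ?_ _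
    refine tendsto_const_nhds.congr' ?_
    filter_upwards [mem_nhdsWithin_of_mem_nhds (gt_mem_nhds hx.1)] with ε hε
    rw [max_eq_left hε.le]

theorem RegularlyGrowing.tendsto_sum_primes {θ : ℝ → ℝ} {α : ℝ} (h : RegularlyGrowing θ α)
    (hα : 0 < α) (s t : ℝ) :
    Tendsto (fun y : ℝ => ∑ p ∈ primesLogLE y, (1 / (p : ℝ)) •
        (cexp ((s * (θ (Real.log p) / θ y) + t * (Real.log p / y) : ℝ) * I) - 1)) atTop
      (𝓝 (∫ x in Set.Ioc (0 : ℝ) 1, (1 / x) • limitPhase α s t x)) := by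
  obtain ⟨K, y₀, hK⟩ := h.exists_sum_le hα
  obtain ⟨K', y₀', hK'⟩ := (regularlyGrowing_rpow hα.le).exists_sum_le hα
  obtain ⟨A, hA, hpos, hm⟩ := h.eventually
  -- The first term is the error from primes with `log p > ε y`; the others bound the `θ`, power and
  -- linear parts over the remaining small primes.
  set ρ : ℝ → ℝ := fun ε => |s| * (2 * ε) + |s| * (|K| * (ε ^ α + ε)) + |s| * (|K'| * ε ^ α)
    + 2 * |t| * (2 * ε) with hρ
  set S : ℝ → ℂ := fun y => ∑ p ∈ primesLogLE y, (1 / (p : ℝ)) •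
        (cexp ((s * (θ (Real.log p) / θ y) + t * (Real.log p / y) : ℝ) * I) - 1) with hS
  set V : ℝ → ℝ → ℂ := fun ε y => (1 / y) • ∑ p ∈ primesLogLE y, (Real.log p / p) •
    ((1 / max (Real.log p / y) ε) • limitPhase α s t (Real.log p / y)) with hV
  have hdiff : ∀ ε, 0 < ε → ε < 1 → ∀ᶠ y in atTop, ‖S y - V ε y‖ ≤ ρ ε := by
    intro ε hε hε1
    -- Accuracy `ε ^ 2` is needed because the sum of `1 / p` over the large primes is only bounded
    -- by `2 / ε`.
    have e1 := h.eventually_abs_sub_le hα.le hε (by positivity : 0 < ε ^ 2)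
    have e2 := tendsto_mertensSum_div.eventually (gt_mem_nhds (by norm_num : (1 : ℝ) < 2))
    have e3 := (h.tendsto ε hε).eventually (gt_mem_nhds (by linarith : ε ^ α < ε ^ α + ε))
    have e4 := (tendsto_mertensSum_mul_div hε.le).eventually
      (gt_mem_nhds (by linarith : ε < 2 * ε))
    filter_upwards [e1, e2, e3, e4, eventually_ge_atTop A, eventually_ge_atTop (y₀ / ε),
      eventually_ge_atTop (y₀' / ε), eventually_ge_atTop (A / ε)] with y h1 h2 h3 h4 h5 h6 h7 h8
    have hy : 0 < y := hA.trans_le h5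
    have hθ := hpos y h5
    rw [div_le_iff₀ hε, mul_comm] at h6 h7 h8
    have hterm : ∀ p ∈ primesLogLE y,
        ‖(1 / (p : ℝ)) • (cexp ((s * (θ (Real.log p) / θ y) + t * (Real.log p / y) : ℝ) * I) - 1)
          - (1 / y) • (Real.log p / p) • ((1 / max (Real.log p / y) ε) •
            limitPhase α s t (Real.log p / y))‖
        ≤ if ε * y < Real.log p then |s| * ε ^ 2 * (1 / (p : ℝ)) else
          |s| * (|θ (Real.log p)| / p / θ y) + |s| * (|(Real.log p) ^ α| / p / y ^ α)
            + 2 * |t| * (Real.log p / p / y) := by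
      intro p hp
      rw [mem_primesLogLE] at hp
      have hp0 : (0 : ℝ) < p := by exact_mod_cast hp.1.pos
      have hl0 := log_prime_pos hp.1
      set x := Real.log p / y with hx
      have hx0 : 0 < x := by positivity
      have hlx : Real.log p = x * y := by rw [hx]; field_simp
      -- The factor caused by the truncation: 1 on large primes, at most 1 on small ones.
      set m := x / max x ε with hmdef
      have hm0 : 0 ≤ m := by positivity
      have hrw : (1 / y) • (Real.log p / p) • ((1 / max x ε) • limitPhase α s t x)
          = (1 / (p : ℝ)) • (m • limitPhase α s t x) := by
        rw [smul_smul, smul_smul, smul_smul]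
        congr 1
        rw [hmdef, hx]
        field_simp
      rw [hrw, ← smul_sub, norm_smul, Real.norm_of_nonneg (by positivity)]
      split_ifs with hc
      · have hxε : ε < x := by rwa [hx, lt_div_iff₀ hy]
        have hx1 : x ≤ 1 := by rw [hx, div_le_one hy]; exact hp.2
        have hm1 : m = 1 := by rw [hmdef, max_eq_left hxε.le, div_self hx0.ne']
        rw [hm1, one_smul, mul_comm]
        refine mul_le_mul_of_nonneg_right ?_ (by positivity)
        rw [limitPhase, sub_sub_sub_cancel_right]
        refine (norm_exp_mul_I_sub_exp_mul_I_le _ _).trans ?_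
        rw [add_sub_add_right_eq_sub, ← mul_sub, abs_mul, hlx]
        exact mul_le_mul_of_nonneg_left (h1 x ⟨hxε.le, hx1⟩).le (abs_nonneg s)
      · have hm1 : m ≤ 1 := div_le_one_of_le₀ (le_max_left _ _) (by positivity)
        have b1 : ‖cexp ((s * (θ (Real.log p) / θ y) + t * x : ℝ) * I) - 1‖
            ≤ |s| * (|θ (Real.log p)| / θ y) + |t| * x := by
          refine (norm_exp_mul_I_sub_one_le _).trans ((abs_add_le _ _).trans (le_of_eq ?_))
          rw [abs_mul, abs_mul, abs_div, abs_of_pos hθ, abs_of_pos hx0]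
        have b2 : ‖m • limitPhase α s t x‖ ≤ |s| * x ^ α + |t| * x := by
          rw [norm_smul, Real.norm_of_nonneg hm0]
          exact (mul_le_of_le_one_left (norm_nonneg _) hm1).trans (norm_limitPhase_le_add hx0.le)
        calc 1 / (p : ℝ) * _ ≤ 1 / (p : ℝ) * ((|s| * (|θ (Real.log p)| / θ y) + |t| * x)
              + (|s| * x ^ α + |t| * x)) := by
              gcongr
              exact (norm_sub_le _ _).trans (add_le_add b1 b2)
          _ = _ := by
              rw [abs_of_pos (Real.rpow_pos_of_pos hl0 α), hx, Real.div_rpow hl0.le hy.le]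
              ring
    have hnot : (primesLogLE y).filter (fun p : ℕ => ¬ ε * y < Real.log p)
        = primesLogLE (ε * y) := by
      ext p
      rw [Finset.mem_filter, mem_primesLogLE, mem_primesLogLE, not_lt, and_assoc]
      refine and_congr_right fun _ => ⟨fun h => h.2, fun h => ⟨h.trans ?_, h⟩⟩
      exact mul_le_of_le_one_left hy.le hε1.le
    have hSV : S y - V ε y = ∑ p ∈ primesLogLE y, ((1 / (p : ℝ)) •
        (cexp ((s * (θ (Real.log p) / θ y) + t * (Real.log p / y) : ℝ) * I) - 1)
          - (1 / y) • (Real.log p / p) • ((1 / max (Real.log p / y) ε) •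
            limitPhase α s t (Real.log p / y))) := by
      simp only [hS, hV]
      rw [Finset.smul_sum, ← Finset.sum_sub_distrib]
    rw [hSV]
    refine (norm_sum_le_of_le _ hterm).trans ?_
    rw [Finset.sum_ite, hnot, Finset.sum_add_distrib, Finset.sum_add_distrib, ← Finset.mul_sum,
      ← Finset.mul_sum, ← Finset.mul_sum, ← Finset.mul_sum, ← Finset.sum_div, ← Finset.sum_div,
      ← Finset.sum_div]
    have c1 := (sum_one_div_primes_le hε hy).trans
      (div_le_div_of_nonneg_right h2.le hε.le)
    have c1' : |s| * ε ^ 2 * ∑ p ∈ primesLogLE y with ε * y < Real.log (p : ℕ), 1 / (p : ℝ)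
        ≤ |s| * (2 * ε) := by
      refine (mul_le_mul_of_nonneg_left c1 (by positivity)).trans (le_of_eq ?_)
      field_simp
    have c2 : (∑ p ∈ primesLogLE (ε * y), |θ (Real.log p)| / p) / θ y ≤ |K| * (ε ^ α + ε) := by
      have h9 := (hK _ h6).trans
        (mul_le_mul_of_nonneg_right (le_abs_self K) (hpos _ h8).le)
      calc _ ≤ |K| * θ (ε * y) / θ y := div_le_div_of_nonneg_right h9 hθ.le
        _ = |K| * (θ (ε * y) / θ y) := by ring
        _ ≤ |K| * (ε ^ α + ε) := mul_le_mul_of_nonneg_left h3.le (abs_nonneg K)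
    have c3 : (∑ p ∈ primesLogLE (ε * y), |(Real.log p) ^ α| / p) / y ^ α ≤ |K'| * ε ^ α := by
      have hyα := Real.rpow_pos_of_pos hy α
      rw [div_le_iff₀ hyα, mul_assoc, ← Real.mul_rpow hε.le hy.le]
      exact (hK' _ h7).trans (mul_le_mul_of_nonneg_right (le_abs_self _) (by positivity))
    have c4 : (∑ p ∈ primesLogLE (ε * y), Real.log p / p) / y ≤ 2 * ε := h4.le
    have d2 := mul_le_mul_of_nonneg_left c2 (abs_nonneg s)
    have d3 := mul_le_mul_of_nonneg_left c3 (abs_nonneg s)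
    have d4 := mul_le_mul_of_nonneg_left c4 (by positivity : 0 ≤ 2 * |t|)
    simp only [hρ]
    exact add_le_add c1' (add_le_add (add_le_add d2 d3) d4) |>.trans (le_of_eq (by ring))
  have hVlim : ∀ ε, 0 < ε → Tendsto (V ε) atTop
      (𝓝 (∫ x in Set.Ioc (0 : ℝ) 1, (1 / max x ε) • limitPhase α s t x)) := by
    intro ε hε
    have hne : ∀ x : ℝ, max x ε ≠ 0 := fun x => (lt_max_of_lt_right hε).ne'
    have hc := continuous_limitPhase hα.le s t
    refine tendsto_sum_log_div_mul (k := fun x => (1 / max x ε) • limitPhase α s t x)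
      (by fun_prop (disch := simp [hne])) (C := 1 / ε * 2) fun x => ?_
    rw [norm_smul, Real.norm_of_nonneg (by positivity)]
    gcongr
    · exact le_max_right _ _
    · exact norm_limitPhase_le_two α s t x
  have hρ0 : Tendsto ρ (𝓝[>] 0) (𝓝 0) := by
    have hc : Continuous ρ := by
      have := Real.continuous_rpow_const hα.le
      fun_prop
    have := hc.tendsto 0
    simp only [hρ, Real.zero_rpow hα.ne', mul_zero, add_zero] at this
    exact this.mono_left nhdsWithin_le_nhds
  rw [Metric.tendsto_nhds]
  intro r hr
  have hI := Metric.tendsto_nhds.1 (tendsto_integral_limitPhase_div_max hα s t) (r / 3)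
    (by linarith)
  have hpos0 : ∀ᶠ ε : ℝ in 𝓝[>] 0, ε ∈ Set.Ioo (0 : ℝ) 1 := Ioo_mem_nhdsGT zero_lt_one
  obtain ⟨ε, hε1, hε2, hε3, hε4⟩ :=
    ((hρ0.eventually (gt_mem_nhds (by linarith : 0 < r / 3))).and (hI.and hpos0)).exists
  filter_upwards [hdiff ε hε3 hε4, Metric.tendsto_nhds.1 (hVlim ε hε3) (r / 3) (by linarith)]
    with y h1 h2
  rw [← dist_eq_norm] at h1
  refine (dist_triangle4 _ (V ε y)
    (∫ x in Set.Ioc (0 : ℝ) 1, (1 / max x ε) • limitPhase α s t x) _).trans_lt ?_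
  have h3 := add_lt_add (add_lt_add (h1.trans_lt hε1) h2) hε2
  rwa [add_thirds] at h3

end PrimeSum

/-! ### The law on smooth numbers and its Euler product. -/

section EulerProduct

open Complex

theorem summable_one_div_prime_pow {p : ℕ} (hp : p.Prime) :
    Summable fun e : ℕ => 1 / (p : ℝ) ^ e := by
  have h1 : (1 : ℝ) < p := by exact_mod_cast hp.one_lt
  simpa [one_div] using summable_geometric_of_lt_one (by positivity) (inv_lt_one_of_one_lt₀ h1)

theorem tsum_one_div_prime_pow {p : ℕ} (hp : p.Prime) :
    ∑' e : ℕ, 1 / (p : ℝ) ^ e = (1 - 1 / (p : ℝ))⁻¹ := by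
  have h1 : (1 : ℝ) < p := by exact_mod_cast hp.one_lt
  simpa [one_div] using tsum_geometric_of_lt_one (by positivity) (inv_lt_one_of_one_lt₀ h1)

theorem norm_one_div_smul_exp (a : ℝ) (ha : 0 ≤ a) (x : ℝ) : ‖(1 / a) • cexp (x * I)‖ = 1 / a := by
  rw [norm_smul, Complex.norm_exp_ofReal_mul_I, mul_one, Real.norm_of_nonneg (by positivity)]

/-- Additivity of `g` makes `e^{i g(k)} / k` multiplicative. The index is `n + 1` because
`Nat.smoothNumbers` bounds the prime factors strictly. -/
theorem hasSum_smoothNumbers {g : ℕ → ℝ} (h1 : g 1 = 0)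
    (hg : ∀ m k : ℕ, m.Coprime k → g (m * k) = g m + g k) (n : ℕ) :
    HasSum ((n + 1).smoothNumbers.indicator fun k : ℕ => (1 / (k : ℝ)) • cexp (g k * I))
      (∏ p ∈ Nat.primesLE n, ∑' e : ℕ, (1 / (p : ℝ) ^ e) • cexp (g (p ^ e) * I)) := by
  have h := (EulerProduct.summable_and_hasSum_smoothNumbers_prod_primesBelow_tsum
    (f := fun k : ℕ => (1 / (k : ℝ)) • cexp (g k * I)) (by simp [h1]) (fun {m k} hmk => by
      simp only [hg m k hmk, Complex.real_smul]
      push_cast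
      rw [add_mul, Complex.exp_add]
      ring) (fun {p} hp => by
      simp_rw [norm_one_div_smul_exp _ (Nat.cast_nonneg _), Nat.cast_pow]
      exact summable_one_div_prime_pow hp) (n + 1)).2
  rw [← hasSum_subtype_iff_indicator]
  simp only [Nat.cast_pow] at h
  exact h

/-- The sum of `1 / k` over the `n`-smooth numbers `k`. -/
noncomputable def smoothTotal (n : ℕ) : ℝ := ∏ p ∈ Nat.primesLE n, (1 - 1 / (p : ℝ))⁻¹

theorem one_sub_one_div_prime_pos {p : ℕ} (hp : p.Prime) : 0 < 1 - 1 / (p : ℝ) := by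
  have h1 : (1 : ℝ) < p := by exact_mod_cast hp.one_lt
  have := (div_lt_one (by linarith)).2 h1
  linarith

theorem smoothTotal_pos (n : ℕ) : 0 < smoothTotal n :=
  Finset.prod_pos fun _ hp => inv_pos.2 (one_sub_one_div_prime_pos (Nat.prime_of_mem_primesLE hp))

theorem hasSum_one_div_smoothNumbers (n : ℕ) :
    HasSum ((n + 1).smoothNumbers.indicator fun k : ℕ => 1 / (k : ℝ)) (smoothTotal n) := by
  have h := hasSum_smoothNumbers (g := fun _ => 0) rfl (by simp) n
  rw [← Complex.hasSum_ofReal]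
  convert h using 1
  · ext k
    by_cases hk : k ∈ (n + 1).smoothNumbers <;> simp [hk]
  · rw [smoothTotal, Complex.ofReal_prod]
    refine Finset.prod_congr rfl fun p hp => ?_
    rw [← tsum_one_div_prime_pow (Nat.prime_of_mem_primesLE hp), Complex.ofReal_tsum]
    simp

/-- The mass at `k` of the law on the `n`-smooth numbers proportional to `1 / k`. -/
noncomputable def smoothWeight (n k : ℕ) : ℝ :=
  (n + 1).smoothNumbers.indicator (fun k : ℕ => 1 / (k : ℝ)) k / smoothTotal n

theorem smoothWeight_nonneg (n k : ℕ) : 0 ≤ smoothWeight n k :=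
  div_nonneg (Set.indicator_nonneg (fun _ _ => by positivity) _) (smoothTotal_pos n).le

theorem smoothWeight_le (n k : ℕ) : smoothWeight n k ≤ 1 / (k : ℝ) / smoothTotal n :=
  div_le_div_of_nonneg_right (Set.indicator_le_self' (fun _ _ => by positivity) k)
    (smoothTotal_pos n).le

theorem smoothWeight_zero (n : ℕ) : smoothWeight n 0 = 0 :=
  le_antisymm ((smoothWeight_le n 0).trans (by simp)) (smoothWeight_nonneg n 0)

theorem smoothWeight_of_le {n k : ℕ} (hk : 1 ≤ k) (hkn : k ≤ n) :
    smoothWeight n k = 1 / (k : ℝ) / smoothTotal n := by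
  rw [smoothWeight, Set.indicator_of_mem (Nat.mem_smoothNumbers_of_lt hk (by omega))]

theorem hasSum_smoothWeight (n : ℕ) : HasSum (smoothWeight n) 1 := by
  have h := (hasSum_one_div_smoothNumbers n).div_const (smoothTotal n)
  rwa [div_self (smoothTotal_pos n).ne'] at h

/-- The law on the `n`-smooth numbers proportional to `1 / k`. -/
noncomputable def smoothLaw (n : ℕ) : Measure ℕ :=
  Measure.sum fun k => ENNReal.ofReal (smoothWeight n k) • Measure.dirac k

instance isProbabilityMeasure_smoothLaw (n : ℕ) : IsProbabilityMeasure (smoothLaw n) :=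
  (hasSum_smoothWeight n).isProbabilityMeasure_sum_dirac (smoothWeight_nonneg n)

/-- `E exp (i u(ξ))` for `ξ` geometric with `P(ξ = e) = (1 - 1 / p) p⁻ᵉ`. -/
noncomputable def geomCharFun (p : ℕ) (u : ℕ → ℝ) : ℂ :=
  (1 - 1 / (p : ℝ)) • ∑' e : ℕ, (1 / (p : ℝ) ^ e) • cexp (u e * I)

theorem integral_smoothLaw_exp {g : ℕ → ℝ} (h1 : g 1 = 0)
    (hg : ∀ m k : ℕ, m.Coprime k → g (m * k) = g m + g k) (n : ℕ) :
    ∫ k, cexp (g k * I) ∂(smoothLaw n)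
      = ∏ p ∈ Nat.primesLE n, geomCharFun p fun e => g (p ^ e) := by
  rw [smoothLaw, integral_sum_dirac (by simp)]
  have h := (hasSum_smoothNumbers h1 hg n).const_smul (smoothTotal n)⁻¹
  simp only [geomCharFun]
  rw [Finset.prod_smul]
  have hZ : ∏ p ∈ Nat.primesLE n, (1 - 1 / (p : ℝ)) = (smoothTotal n)⁻¹ := by
    rw [smoothTotal, Finset.prod_inv_distrib, inv_inv]
  rw [hZ, ← h.tsum_eq]
  refine tsum_congr fun k => ?_
  rw [ENNReal.toReal_ofReal (smoothWeight_nonneg n k), smoothWeight, div_eq_inv_mul, mul_smul]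
  congr 1
  by_cases hk : k ∈ (n + 1).smoothNumbers <;> simp [hk]

theorem summable_one_div_pow_smul_exp {p : ℕ} (hp : p.Prime) (u : ℕ → ℝ) :
    Summable fun e : ℕ => (1 / (p : ℝ) ^ e) • cexp (u e * I) :=
  Summable.of_norm (by
    simp_rw [norm_one_div_smul_exp _ (pow_nonneg (Nat.cast_nonneg p) _)]
    exact summable_one_div_prime_pow hp)

theorem norm_geomCharFun_le_one {p : ℕ} (hp : p.Prime) (u : ℕ → ℝ) : ‖geomCharFun p u‖ ≤ 1 := by
  have h0 := one_sub_one_div_prime_pos hp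
  have h2 : ‖∑' e : ℕ, (1 / (p : ℝ) ^ e) • cexp (u e * I)‖ ≤ (1 - 1 / (p : ℝ))⁻¹ := by
    rw [← tsum_one_div_prime_pow hp]
    refine tsum_of_norm_bounded (summable_one_div_prime_pow hp).hasSum fun e => ?_
    rw [norm_one_div_smul_exp _ (by positivity)]
  rw [geomCharFun, norm_smul, Real.norm_of_nonneg h0.le]
  calc _ ≤ (1 - 1 / (p : ℝ)) * (1 - 1 / (p : ℝ))⁻¹ := by gcongr
    _ = 1 := mul_inv_cancel₀ h0.ne'

theorem norm_exp_one_div_smul_le_one (p : ℕ) (x : ℝ) :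
    ‖cexp ((1 / (p : ℝ)) • (cexp (x * I) - 1))‖ ≤ 1 := by
  rw [Complex.norm_exp, Real.exp_le_one_iff, Complex.smul_re, Complex.sub_re,
    Complex.exp_ofReal_mul_I_re, Complex.one_re, smul_eq_mul]
  exact mul_nonpos_of_nonneg_of_nonpos (by positivity) (by linarith [Real.cos_le_one x])

/-- Both terms equal `1 + (e^{i u(1)} - 1) / p + O(p⁻²)`, uniformly in `u`. The constant is `6 = 1 +
1 + 4`: the cross term, the exponents `e ≥ 2`, and the quadratic remainder of `exp`. -/
theorem norm_geomCharFun_sub_le {p : ℕ} (hp : p.Prime) {u : ℕ → ℝ} (hu : u 0 = 0) :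
    ‖geomCharFun p u - cexp ((1 / (p : ℝ)) • (cexp (u 1 * I) - 1))‖ ≤ 6 * (1 / (p : ℝ) ^ 2) := by
  have hp2 : (2 : ℝ) ≤ p := by exact_mod_cast hp.two_le
  have h0 := one_sub_one_div_prime_pos hp
  set E := cexp (u 1 * I) with hE
  have hE1 : ‖E‖ = 1 := Complex.norm_exp_ofReal_mul_I _
  set w : ℂ := (1 / (p : ℝ)) • (E - 1) with hw
  set r : ℂ := ∑' e : ℕ, (1 / (p : ℝ) ^ (e + 2)) • cexp (u (e + 2) * I) with hr
  have hsum : ∑' e : ℕ, (1 / (p : ℝ) ^ e) • cexp (u e * I) = 1 + (1 / (p : ℝ)) • E + r := by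
    rw [← (summable_one_div_pow_smul_exp hp u).sum_add_tsum_nat_add 2, Finset.sum_range_succ,
      Finset.sum_range_one, hr, hu]
    simp [hE]
  have hrn : ‖r‖ ≤ 1 / (p : ℝ) ^ 2 * (1 - 1 / (p : ℝ))⁻¹ := by
    rw [← tsum_one_div_prime_pow hp]
    refine tsum_of_norm_bounded ((summable_one_div_prime_pow hp).hasSum.mul_left _) fun e => ?_
    rw [norm_one_div_smul_exp _ (by positivity), pow_add]
    exact le_of_eq (by field_simp)
  have hdec : geomCharFun p u - cexp w = -(1 / (p : ℝ) ^ 2) • E + (1 - 1 / (p : ℝ)) • r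
      - (cexp w - 1 - w) := by
    rw [geomCharFun, hsum, hw]
    simp only [Complex.real_smul]
    push_cast
    ring
  have hw1 : ‖w‖ ≤ 2 / p := by
    rw [hw, norm_smul, Real.norm_of_nonneg (by positivity)]
    have : ‖E - 1‖ ≤ 2 := by
      refine (norm_sub_le _ _).trans ?_
      rw [hE1, norm_one]
      norm_num
    calc 1 / (p : ℝ) * ‖E - 1‖ ≤ 1 / (p : ℝ) * 2 := by gcongr
      _ = 2 / p := by ring
  have hw2 : ‖w‖ ≤ 1 := hw1.trans ((div_le_one (by linarith)).2 hp2)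
  have hw3 : ‖cexp w - 1 - w‖ ≤ 4 * (1 / (p : ℝ) ^ 2) := by
    refine (Complex.norm_exp_sub_one_sub_id_le hw2).trans ?_
    calc ‖w‖ ^ 2 ≤ (2 / (p : ℝ)) ^ 2 := by gcongr
      _ = 4 * (1 / (p : ℝ) ^ 2) := by ring
  have hr2 : ‖(1 - 1 / (p : ℝ)) • r‖ ≤ 1 / (p : ℝ) ^ 2 := by
    rw [norm_smul, Real.norm_of_nonneg h0.le]
    calc _ ≤ (1 - 1 / (p : ℝ)) * (1 / (p : ℝ) ^ 2 * (1 - 1 / (p : ℝ))⁻¹) := by gcongr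
      _ = 1 / (p : ℝ) ^ 2 * ((1 - 1 / (p : ℝ)) * (1 - 1 / (p : ℝ))⁻¹) := by ring
      _ = 1 / (p : ℝ) ^ 2 := by rw [mul_inv_cancel₀ h0.ne', mul_one]
  have hE2 : ‖-(1 / (p : ℝ) ^ 2) • E‖ = 1 / (p : ℝ) ^ 2 := by
    rw [norm_smul, hE1, mul_one, norm_neg, Real.norm_of_nonneg (by positivity)]
  rw [hdec]
  calc _ ≤ ‖-(1 / (p : ℝ) ^ 2) • E‖ + ‖(1 - 1 / (p : ℝ)) • r‖ + ‖cexp w - 1 - w‖ :=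
        (norm_sub_le _ _).trans (add_le_add_left (norm_add_le _ _) _)
    _ ≤ _ := by linarith

theorem tendsto_geomCharFun {p : ℕ} (hp : p.Prime) {u : ℕ → ℕ → ℝ}
    (hu : ∀ e, Tendsto (fun n => u n e) atTop (𝓝 0)) :
    Tendsto (fun n => geomCharFun p (u n)) atTop (𝓝 1) := by
  have h := tendsto_tsum_of_dominated_convergence (𝓕 := atTop)
    (f := fun n e => (1 / (p : ℝ) ^ e) • cexp (u n e * I))
    (g := fun e => (1 / (p : ℝ) ^ e) • (1 : ℂ)) (summable_one_div_prime_pow hp) (fun e => by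
      have h1 : Continuous fun x : ℝ => (1 / (p : ℝ) ^ e) • cexp (x * I) := by fun_prop
      simpa [Function.comp_def] using (h1.tendsto 0).comp (hu e))
    (Eventually.of_forall fun n e => by rw [norm_one_div_smul_exp _ (by positivity)])
  have h2 : ∑' e : ℕ, (1 / (p : ℝ) ^ e) • (1 : ℂ) = ((1 - 1 / (p : ℝ))⁻¹ : ℝ) := by
    rw [← tsum_one_div_prime_pow hp, Complex.ofReal_tsum]
    simp
  rw [h2] at h
  have h3 := h.const_smul (1 - 1 / (p : ℝ))
  have h4 : (1 - 1 / (p : ℝ)) • (((1 - 1 / (p : ℝ))⁻¹ : ℝ) : ℂ) = 1 := by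
    rw [Complex.real_smul, ← Complex.ofReal_mul,
      mul_inv_cancel₀ (one_sub_one_div_prime_pos hp).ne', Complex.ofReal_one]
  rwa [h4] at h3

/-- Telescoping: factors are exchanged one at a time, the others having norm at most 1. -/
theorem norm_prod_sub_prod_le {ι : Type*} (s : Finset ι) (a b : ι → ℂ)
    (ha : ∀ i ∈ s, ‖a i‖ ≤ 1) (hb : ∀ i ∈ s, ‖b i‖ ≤ 1) :
    ‖∏ i ∈ s, a i - ∏ i ∈ s, b i‖ ≤ ∑ i ∈ s, ‖a i - b i‖ := by
  classical
  induction s using Finset.induction_on with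
  | empty => simp
  | insert j s hj ih =>
    have ih' := ih (fun i hi => ha i (Finset.mem_insert_of_mem hi))
      fun i hi => hb i (Finset.mem_insert_of_mem hi)
    have hP : ‖∏ i ∈ s, a i‖ ≤ 1 := by
      rw [norm_prod]
      exact Finset.prod_le_one (fun _ _ => norm_nonneg _)
        fun i hi => ha i (Finset.mem_insert_of_mem hi)
    rw [Finset.prod_insert hj, Finset.prod_insert hj, Finset.sum_insert hj]
    calc ‖a j * ∏ i ∈ s, a i - b j * ∏ i ∈ s, b i‖
        = ‖(a j - b j) * ∏ i ∈ s, a i + b j * (∏ i ∈ s, a i - ∏ i ∈ s, b i)‖ := by ring_nf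
      _ ≤ ‖a j - b j‖ * ‖∏ i ∈ s, a i‖ + ‖b j‖ * ‖∏ i ∈ s, a i - ∏ i ∈ s, b i‖ := by
          rw [← norm_mul, ← norm_mul]
          exact norm_add_le _ _
      _ ≤ ‖a j - b j‖ * 1 + 1 * ∑ i ∈ s, ‖a i - b i‖ := by
          gcongr
          exact hb j (Finset.mem_insert_self _ _)
      _ = _ := by ring

theorem tendsto_prod_geomCharFun {u : ℕ → ℕ → ℕ → ℝ} (h0 : ∀ n p, u n p 0 = 0)
    (hu : ∀ p : ℕ, ∀ e, Tendsto (fun n => u n p e) atTop (𝓝 0)) {c : ℂ}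
    (hc : Tendsto (fun n => ∑ p ∈ Nat.primesLE n, (1 / (p : ℝ)) • (cexp (u n p 1 * I) - 1))
      atTop (𝓝 c)) :
    Tendsto (fun n => ∏ p ∈ Nat.primesLE n, geomCharFun p (u n p)) atTop (𝓝 (cexp c)) := by
  set b : ℕ → ℕ → ℂ := fun n p => cexp ((1 / (p : ℝ)) • (cexp (u n p 1 * I) - 1)) with hb
  have hprod : Tendsto (fun n => ∏ p ∈ Nat.primesLE n, b n p) atTop (𝓝 (cexp c)) := by
    simp only [hb, ← Complex.exp_sum]
    exact (Complex.continuous_exp.tendsto c).comp hc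
  -- Each fixed prime contributes an error tending to 0, and `6 / p ^ 2` is a summable bound
  -- independent of `n`.
  have hD : Tendsto (fun n => ∑ p ∈ Nat.primesLE n, ‖geomCharFun p (u n p) - b n p‖) atTop
      (𝓝 0) := by
    have h := tendsto_tsum_of_dominated_convergence (𝓕 := atTop)
      (f := fun n p => if p ∈ Nat.primesLE n then ‖geomCharFun p (u n p) - b n p‖ else 0)
      (g := fun _ : ℕ => (0 : ℝ)) (bound := fun p => 6 * (1 / (p : ℝ) ^ 2))
      ((Real.summable_one_div_nat_pow.2 (by norm_num)).mul_left 6) (fun p => by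
        by_cases hp : p.Prime
        · have h1 : Tendsto (fun n => b n p) atTop (𝓝 1) := by
            have hcont : Continuous fun x : ℝ => cexp ((1 / (p : ℝ)) • (cexp (x * I) - 1)) := by
              fun_prop
            simpa [Function.comp_def, hb] using (hcont.tendsto 0).comp (hu p 1)
          have h2 := ((tendsto_geomCharFun hp (hu p)).sub h1).norm
          rw [sub_self, norm_zero] at h2
          refine squeeze_zero (fun n => ?_) (fun n => ?_) h2
          · split_ifs <;> positivity
          · split_ifs
            · exact le_rfl
            · positivity
        · refine tendsto_const_nhds.congr fun n => ?_
          rw [if_neg fun hpn => hp (Nat.prime_of_mem_primesLE hpn)])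
      (Eventually.of_forall fun n p => by
        split_ifs with hp
        · rw [norm_norm]
          exact norm_geomCharFun_sub_le (Nat.prime_of_mem_primesLE hp) (h0 n p)
        · rw [norm_zero]
          positivity)
    rw [tsum_zero] at h
    refine h.congr fun n => ?_
    rw [tsum_eq_sum (s := Nat.primesLE n) fun p hp => if_neg hp]
    exact Finset.sum_congr rfl fun p hp => if_pos hp
  have hdiff : Tendsto (fun n => ∏ p ∈ Nat.primesLE n, geomCharFun p (u n p)
      - ∏ p ∈ Nat.primesLE n, b n p) atTop (𝓝 0) :=
    squeeze_zero_norm (fun n => norm_prod_sub_prod_le _ _ _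
      (fun p hp => norm_geomCharFun_le_one (Nat.prime_of_mem_primesLE hp) _)
      fun p _ => norm_exp_one_div_smul_le_one p _) hD
  simpa using hdiff.add hprod

theorem iota_prime_pow {θ : ℝ → ℝ} (h0 : θ 0 = 0) {p : ℕ} (hp : p.Prime) (e : ℕ) :
    iota θ (p ^ e) = θ (e * Real.log p) := by
  rw [iota, hp.factorization_pow, Finsupp.sum_single_index]
  simp [h0]

theorem iota_mul_of_coprime (θ : ℝ → ℝ) {m k : ℕ} (h : m.Coprime k) :
    iota θ (m * k) = iota θ m + iota θ k := by
  rw [iota, Nat.factorization_mul_of_coprime h, Finsupp.sum_add_index_of_disjoint]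
  · rfl
  · simpa using h.disjoint_primeFactors

theorem iota_one (θ : ℝ → ℝ) : iota θ 1 = 0 := by simp [iota]

theorem log_mul_of_coprime {m k : ℕ} (h : m.Coprime k) :
    Real.log (m * k : ℕ) = Real.log m + Real.log k := by
  rcases Nat.eq_zero_or_pos m with rfl | hm
  · simp [Nat.coprime_zero_left _ |>.1 h]
  rcases Nat.eq_zero_or_pos k with rfl | hk
  · simp [Nat.coprime_zero_right _ |>.1 h]
  rw [Nat.cast_mul, Real.log_mul (by positivity) (by positivity)]

/-- Under the law on `n`-smooth numbers, the joint characteristic function of the normalised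
additive function and the normalised logarithm converges. -/
theorem RegularlyGrowing.tendsto_integral_smoothLaw {θ : ℝ → ℝ} {α : ℝ}
    (h : RegularlyGrowing θ α) (hα : 0 < α) (h0 : θ 0 = 0) (s t : ℝ) :
    Tendsto (fun n : ℕ => ∫ k, cexp ((s * (iota θ k / θ (Real.log n))
        + t * (Real.log k / Real.log n) : ℝ) * I) ∂(smoothLaw n)) atTop
      (𝓝 (cexp (∫ x in Set.Ioc (0 : ℝ) 1, (1 / x) • limitPhase α s t x))) := by
  have hlog : Tendsto (fun n : ℕ => Real.log n) atTop atTop :=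
    Real.tendsto_log_atTop.comp tendsto_natCast_atTop_atTop
  have key := tendsto_prod_geomCharFun
    (u := fun n p e => s * (θ (e * Real.log p) / θ (Real.log n))
      + t * (e * Real.log p / Real.log n)) (fun n p => by simp [h0]) (fun p e => by
        have h1 := (tendsto_const_nhds (x := θ (e * Real.log p))).div_atTop
          ((h.tendsto_atTop hα).comp hlog)
        have h2 := (tendsto_const_nhds (x := e * Real.log p)).div_atTop hlog
        simpa using (h1.const_mul s).add (h2.const_mul t)) (by
        refine ((h.tendsto_sum_primes hα s t).comp hlog).congr' ?_
        filter_upwards [eventually_ge_atTop 1] with n hn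
        simp only [Function.comp_apply, primesLogLE_log hn, Nat.cast_one, one_mul])
  refine key.congr fun n => ?_
  rw [integral_smoothLaw_exp (g := fun k => s * (iota θ k / θ (Real.log n))
        + t * (Real.log k / Real.log n)) (by simp [iota_one]) fun m k hmk => by
      rw [iota_mul_of_coprime θ hmk, log_mul_of_coprime hmk]
      ring]
  refine Finset.prod_congr rfl fun p hp => ?_
  congr 1
  ext e
  rw [iota_prime_pow h0 (Nat.prime_of_mem_primesLE hp), Nat.cast_pow, Real.log_pow]

end EulerProduct

/-! ### Conditioning on `k ≤ n`, and joint convergence before conditioning. -/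

section Conditioning

theorem harmonicConst_eq (n : ℕ) : harmonicConst n = harmonic n := by
  rw [harmonic_eq_sum_Icc, harmonicConst]
  simp

theorem log_le_harmonicConst {n : ℕ} (hn : 1 ≤ n) : Real.log n ≤ harmonicConst n := by
  rw [harmonicConst_eq]
  refine le_trans (Real.log_le_log (by exact_mod_cast hn) ?_) (log_add_one_le_harmonic n)
  push_cast
  linarith

theorem harmonicConst_pos {n : ℕ} (hn : 1 ≤ n) : 0 < harmonicConst n :=
  Finset.sum_pos (fun k hk => by
    have : (0 : ℝ) < k := by exact_mod_cast (Finset.mem_Icc.1 hk).1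
    positivity) ⟨1, by simpa using hn⟩

theorem harmonicConst_le_smoothTotal (n : ℕ) : harmonicConst n ≤ smoothTotal n := by
  have h := sum_le_hasSum (Finset.Icc 1 n)
    (fun k _ => Set.indicator_nonneg (fun _ _ => by positivity) k) (hasSum_one_div_smoothNumbers n)
  refine le_trans (Finset.sum_le_sum fun k hk => ?_) h
  rw [Finset.mem_Icc] at hk
  rw [Set.indicator_of_mem (Nat.mem_smoothNumbers_of_lt hk.1 (by omega))]

theorem sum_Ioc_one_div_le {a b : ℕ} (hab : a ≤ b) :
    ∑ k ∈ Finset.Ioc a b, 1 / (k : ℝ) ≤ 1 + Real.log b - Real.log (a + 1 : ℕ) := by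
  have h1 := log_add_one_le_harmonic a
  have h2 := harmonic_le_one_add_log b
  rw [← harmonicConst_eq] at h1 h2
  have h3 : harmonicConst b = harmonicConst a + ∑ k ∈ Finset.Ioc a b, 1 / (k : ℝ) := by
    have e : ∀ m, Finset.Icc 1 m = Finset.Ioc 0 m := fun m => by
      ext k
      simp [Nat.one_le_iff_ne_zero, Nat.pos_iff_ne_zero]
    rw [harmonicConst, harmonicConst, e, e]
    exact (Finset.sum_Ioc_consecutive _ (Nat.zero_le a) hab).symm
  linarith

/-- The `k` in question lie between `n^{1-δ}` and `n^{1+δ}`; their reciprocals sum to at most `1 +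
2δ log n`, and the normaliser is at least `log n`. -/
theorem smoothLaw_near_le {n : ℕ} (hn : 2 ≤ n) {δ : ℝ} (hδ : 0 < δ) (hδ1 : δ ≤ 1) :
    smoothLaw n {k : ℕ | |Real.log k / Real.log n - 1| < δ}
      ≤ ENNReal.ofReal (1 / Real.log n + 2 * δ) := by
  have hl : 0 < Real.log n := Real.log_pos (by exact_mod_cast hn)
  set a := ⌊Real.exp ((1 - δ) * Real.log n)⌋₊ with ha
  set b := ⌊Real.exp ((1 + δ) * Real.log n)⌋₊ with hb
  have hab : a ≤ b := Nat.floor_le_floor (Real.exp_le_exp.2 (by nlinarith))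
  have hb1 : 1 ≤ b := (Nat.one_le_floor_iff _).2 (Real.one_le_exp (by positivity))
  have hsub : {k : ℕ | |Real.log k / Real.log n - 1| < δ} ⊆ (Finset.Ioc a b : Set ℕ) := by
    intro k hk
    rw [Set.mem_ofPred_eq, abs_lt] at hk
    -- As `Real.log 0 = 0`, the point `k = 0` is at distance exactly 1; this is where `δ ≤ 1`
    -- enters.
    have hk0 : k ≠ 0 := by
      rintro rfl
      simp only [CharP.cast_eq_zero, Real.log_zero, zero_div] at hk
      linarith [hk.1]
    have hkp : (0 : ℝ) < k := by positivity
    have h1 : (1 - δ) * Real.log n < Real.log k := by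
      rw [← lt_div_iff₀ hl]
      linarith [hk.1]
    have h2 : Real.log k < (1 + δ) * Real.log n := by
      rw [← div_lt_iff₀ hl]
      linarith [hk.2]
    rw [Finset.coe_Ioc, Set.mem_Ioc]
    constructor
    · rw [ha, Nat.floor_lt (by positivity)]
      exact (Real.lt_log_iff_exp_lt hkp).1 h1
    · rw [hb, Nat.le_floor_iff (by positivity)]
      exact ((Real.log_lt_iff_lt_exp hkp).1 h2).le
  refine (measure_mono hsub).trans ?_
  rw [← sum_measure_singleton]
  have hs : ∀ k, smoothLaw n {k} = ENNReal.ofReal (smoothWeight n k) := fun k => by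
    rw [smoothLaw, Measure.sum_smul_dirac_singleton]
  simp_rw [hs]
  rw [← ENNReal.ofReal_sum_of_nonneg fun k _ => smoothWeight_nonneg n k]
  refine ENNReal.ofReal_le_ofReal ?_
  have hsum : ∑ k ∈ Finset.Ioc a b, 1 / (k : ℝ) ≤ 1 + 2 * δ * Real.log n := by
    refine (sum_Ioc_one_div_le hab).trans ?_
    have h1 : Real.log b ≤ (1 + δ) * Real.log n :=
      (Real.log_le_iff_le_exp (by exact_mod_cast hb1)).2 (Nat.floor_le (by positivity))
    have h2 : (1 - δ) * Real.log n ≤ Real.log (a + 1 : ℕ) := by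
      rw [Real.le_log_iff_exp_le (by positivity)]
      push_cast
      exact (Nat.lt_floor_add_one _).le
    linarith
  have hZ : Real.log n ≤ smoothTotal n :=
    (log_le_harmonicConst (by omega)).trans (harmonicConst_le_smoothTotal n)
  calc ∑ k ∈ Finset.Ioc a b, smoothWeight n k
      ≤ ∑ k ∈ Finset.Ioc a b, 1 / (k : ℝ) / smoothTotal n :=
        Finset.sum_le_sum fun k _ => smoothWeight_le n k
    _ = (∑ k ∈ Finset.Ioc a b, 1 / (k : ℝ)) / smoothTotal n := by rw [Finset.sum_div]
    _ ≤ (1 + 2 * δ * Real.log n) / Real.log n := by gcongr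
    _ = 1 / Real.log n + 2 * δ := by field_simp

theorem smoothLaw_of_subset_Iic {n : ℕ} {S : Set ℕ} (hS : S ⊆ Set.Iic n) :
    smoothLaw n S = ∑ k ∈ Finset.Icc 1 n,
      ENNReal.ofReal (1 / (k : ℝ) / smoothTotal n) * S.indicator 1 k := by
  rw [smoothLaw, Measure.sum_apply _ (Set.to_countable S).measurableSet]
  simp only [Measure.smul_apply, smul_eq_mul, Measure.dirac_apply]
  rw [tsum_eq_sum (s := Finset.Icc 1 n)]
  · refine Finset.sum_congr rfl fun k hk => ?_
    rw [Finset.mem_Icc] at hk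
    rw [smoothWeight_of_le hk.1 hk.2]
  · intro k hk
    rcases Nat.eq_zero_or_pos k with rfl | hk0
    · rw [smoothWeight_zero, ENNReal.ofReal_zero, zero_mul]
    · rw [Set.indicator_of_notMem, mul_zero]
      exact fun hkS => hk (Finset.mem_Icc.2 ⟨hk0, hS hkS⟩)

/-- The harmonic law is the law on the smooth numbers, conditioned on `{1, …, n}`. -/
theorem harmonicLaw_mul_smoothLaw {n : ℕ} (hn : 1 ≤ n) (S : Set ℕ) :
    harmonicLaw n S * smoothLaw n (Set.Iic n) = smoothLaw n (S ∩ Set.Iic n) := by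
  have hZ := smoothTotal_pos n
  have hL := harmonicConst_pos hn
  have h1 : smoothLaw n (Set.Iic n) = ENNReal.ofReal (harmonicConst n / smoothTotal n) := by
    rw [smoothLaw_of_subset_Iic le_rfl, harmonicConst, Finset.sum_div,
      ENNReal.ofReal_sum_of_nonneg fun k _ => by positivity]
    refine Finset.sum_congr rfl fun k hk => ?_
    rw [Set.indicator_of_mem (Set.mem_Iic.2 (Finset.mem_Icc.1 hk).2), Pi.one_apply, mul_one]
  rw [h1, smoothLaw_of_subset_Iic Set.inter_subset_right, harmonicLaw, Measure.finsetSum_apply,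
    Finset.sum_mul]
  refine Finset.sum_congr rfl fun k hk => ?_
  rw [Finset.mem_Icc] at hk
  have hk0 : (0 : ℝ) < k := by exact_mod_cast hk.1
  have h2 : (S ∩ Set.Iic n).indicator (1 : ℕ → ℝ≥0∞) k = S.indicator 1 k := by
    by_cases hkS : k ∈ S <;> simp [hkS, hk.2]
  rw [h2, Measure.smul_apply, smul_eq_mul, Measure.dirac_apply, mul_right_comm,
    ← ENNReal.ofReal_mul (by positivity)]
  congr 2
  field_simp

/-- The normalised additive function and the normalised logarithm. -/
noncomputable def normalizedPair (θ : ℝ → ℝ) (n k : ℕ) : EuclideanSpace ℝ (Fin 2) :=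
  !₂[iota θ k / θ (Real.log n), Real.log k / Real.log n]

variable {Ω : Type*} [MeasurableSpace Ω] {P : Measure Ω} {η : Ω → Measure (ℝ × ℝ)}

/-- The integrals of `x ^ α` and `x` against `η`. -/
noncomputable def poissonPair (η : Ω → Measure (ℝ × ℝ)) (α : ℝ) (ω : Ω) :
    EuclideanSpace ℝ (Fin 2) :=
  !₂[∫ z in unitSquare, z.2 ^ α ∂(η ω), ∫ z in unitSquare, z.2 ∂(η ω)]

theorem IsPoissonRandomMeasure.measurable_setIntegral
    (hη : IsPoissonRandomMeasure η dickmanIntensity P) :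
    Measurable fun ω => ∫ z in unitSquare, z.2 ∂(η ω) := by
  simpa using hη.measurable_setIntegral_rpow 1

theorem IsPoissonRandomMeasure.measurable_poissonPair
    (hη : IsPoissonRandomMeasure η dickmanIntensity P) (α : ℝ) :
    Measurable (poissonPair η α) := by
  refine (WithLp.measurable_toLp 2 _).comp (measurable_pi_lambda _ fun i => ?_)
  fin_cases i
  · exact hη.measurable_setIntegral_rpow α
  · exact hη.measurable_setIntegral

/-- Lévy's continuity theorem in the plane; the second coordinate is carried along to express the
conditioning. -/
theorem RegularlyGrowing.tendsto_map_normalizedPair [IsProbabilityMeasure P]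
    (hη : IsPoissonRandomMeasure η dickmanIntensity P) {θ : ℝ → ℝ} {α : ℝ}
    (h : RegularlyGrowing θ α) (hα : 0 < α) (h0 : θ 0 = 0) :
    Tendsto (β := ProbabilityMeasure (EuclideanSpace ℝ (Fin 2)))
      (fun n => ⟨(smoothLaw n).map (normalizedPair θ n),
        Measure.isProbabilityMeasure_map Measurable.of_discrete.aemeasurable⟩) atTop
      (𝓝 ⟨P.map (poissonPair η α),
        Measure.isProbabilityMeasure_map (hη.measurable_poissonPair α).aemeasurable⟩) := by
  refine ProbabilityMeasure.tendsto_of_tendsto_charFun fun t => ?_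
  simp only [ProbabilityMeasure.coe_mk]
  have hlim : charFun (P.map (poissonPair η α)) t = Complex.exp (∫ x in Set.Ioc (0 : ℝ) 1,
      (1 / x) • limitPhase α (t 0) (t 1) x) := by
    rw [charFun_apply, integral_map (hη.measurable_poissonPair α).aemeasurable (by fun_prop)]
    refine Eq.trans ?_ (hη.charFun_dickman hα (t 0) (t 1))
    refine integral_congr_ae (Eventually.of_forall fun ω => ?_)
    simp [poissonPair, PiLp.inner_apply, Fin.sum_univ_two]
  rw [hlim]
  refine (h.tendsto_integral_smoothLaw hα h0 (t 0) (t 1)).congr fun n => ?_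
  rw [charFun_apply, integral_map Measurable.of_discrete.aemeasurable (by fun_prop)]
  refine integral_congr_ae (Eventually.of_forall fun k => ?_)
  simp [normalizedPair, PiLp.inner_apply, Fin.sum_univ_two]

end Conditioning

/-! ### Passage to the conditional laws. -/

section Limit

variable {Ω : Type*} [MeasurableSpace Ω] {P : Measure Ω} [IsProbabilityMeasure P]
  {η : Ω → Measure (ℝ × ℝ)}

theorem map_normalizedPair_apply (θ : ℝ → ℝ) (n : ℕ) {S : Set (EuclideanSpace ℝ (Fin 2))}
    (hS : MeasurableSet S) :
    (smoothLaw n).map (normalizedPair θ n) S = smoothLaw n (normalizedPair θ n ⁻¹' S) :=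
  Measure.map_apply Measurable.of_discrete hS

/-- The portmanteau inequality on the open strip `|x₁ - 1| < δ` transfers the bound of
`smoothLaw_near_le` to the limit, giving mass at most `2δ` for every small `δ`. -/
theorem RegularlyGrowing.measure_setIntegral_eq_one
    (hη : IsPoissonRandomMeasure η dickmanIntensity P) {θ : ℝ → ℝ} {α : ℝ}
    (h : RegularlyGrowing θ α) (hα : 0 < α) (h0 : θ 0 = 0) :
    P {ω | ∫ z in unitSquare, z.2 ∂(η ω) = 1} = 0 := by
  have hw := h.tendsto_map_normalizedPair hη hα h0
  have hlog : Tendsto (fun n : ℕ => Real.log n) atTop atTop :=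
    Real.tendsto_log_atTop.comp tendsto_natCast_atTop_atTop
  have hbound : ∀ δ : ℝ, 0 < δ → δ ≤ 1 →
      P {ω | ∫ z in unitSquare, z.2 ∂(η ω) = 1} ≤ ENNReal.ofReal (2 * δ) := by
    intro δ hδ hδ1
    set U : Set (EuclideanSpace ℝ (Fin 2)) := {x | |x 1 - 1| < δ} with hU
    have hUo : IsOpen U := isOpen_lt (by fun_prop) continuous_const
    have h1 := ProbabilityMeasure.le_liminf_measure_open_of_tendsto hw hUo
    simp only [ProbabilityMeasure.coe_mk] at h1
    have h2 : P {ω | ∫ z in unitSquare, z.2 ∂(η ω) = 1} ≤ P.map (poissonPair η α) U := by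
      rw [Measure.map_apply (hη.measurable_poissonPair α) hUo.measurableSet]
      refine measure_mono fun ω hω => ?_
      have hω' : ∫ z in unitSquare, z.2 ∂(η ω) = 1 := hω
      simp [hU, poissonPair, hω', hδ]
    have h3 : Tendsto (fun n : ℕ => ENNReal.ofReal (1 / Real.log n + 2 * δ)) atTop
        (𝓝 (ENNReal.ofReal (2 * δ))) := by
      have := (tendsto_const_nhds (x := (1 : ℝ)).div_atTop hlog).add_const (2 * δ)
      rw [zero_add] at this
      exact (ENNReal.continuous_ofReal.tendsto _).comp this
    refine h2.trans (h1.trans ?_)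
    rw [← h3.liminf_eq]
    refine liminf_le_liminf ?_
    filter_upwards [eventually_ge_atTop 2] with n hn
    rw [map_normalizedPair_apply θ n hUo.measurableSet]
    exact smoothLaw_near_le hn hδ hδ1
  have hlim : Tendsto (fun δ : ℝ => ENNReal.ofReal (2 * δ)) (𝓝[>] 0) (𝓝 0) := by
    have hc : Continuous fun δ : ℝ => ENNReal.ofReal (2 * δ) :=
      ENNReal.continuous_ofReal.comp (by fun_prop)
    have := hc.tendsto 0
    rw [mul_zero, ENNReal.ofReal_zero] at this
    exact this.mono_left nhdsWithin_le_nhds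
  refine le_antisymm (ge_of_tendsto hlim ?_) zero_le
  filter_upwards [Ioo_mem_nhdsGT (zero_lt_one (α := ℝ))] with δ hδ
  exact hbound δ hδ.1 hδ.2.le

theorem normalizedPair_preimage_le_one (θ : ℝ → ℝ) {n : ℕ} (hn : 2 ≤ n) :
    normalizedPair θ n ⁻¹' {x | x 1 ≤ 1} = Set.Iic n := by
  have hl : 0 < Real.log n := Real.log_pos (by exact_mod_cast hn)
  have hn0 : (0 : ℝ) < n := by positivity
  ext k
  have : normalizedPair θ n k ∈ {x : EuclideanSpace ℝ (Fin 2) | x 1 ≤ 1}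
      ↔ Real.log k / Real.log n ≤ 1 := by simp [normalizedPair]
  rw [Set.mem_preimage, this, div_le_one hl, Set.mem_Iic]
  rcases Nat.eq_zero_or_pos k with rfl | hk
  -- The convention `log 0 = 0` puts `k = 0` in both sets.
  · simp [hl.le]
  · rw [Real.log_le_log_iff (by exact_mod_cast hk) hn0, Nat.cast_le]

theorem RegularlyGrowing.tendsto_smoothLaw_Iic
    (hη : IsPoissonRandomMeasure η dickmanIntensity P) {θ : ℝ → ℝ} {α : ℝ}
    (h : RegularlyGrowing θ α) (hα : 0 < α) (h0 : θ 0 = 0) :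
    Tendsto (fun n => smoothLaw n (Set.Iic n)) atTop
      (𝓝 (P {ω | ∫ z in unitSquare, z.2 ∂(η ω) ≤ 1})) := by
  set C : Set (EuclideanSpace ℝ (Fin 2)) := {x | x 1 ≤ 1} with hC
  have hCc : IsClosed C := isClosed_le (by fun_prop) continuous_const
  have hfr : P.map (poissonPair η α) (frontier C) = 0 := by
    refine measure_mono_null (frontier_le_subset_eq (by fun_prop) continuous_const) ?_
    rw [Measure.map_apply (hη.measurable_poissonPair α)
      (isClosed_eq (by fun_prop) continuous_const).measurableSet]
    simpa [poissonPair] using h.measure_setIntegral_eq_one hη hα h0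
  have h1 := ProbabilityMeasure.tendsto_measure_of_null_frontier_of_tendsto'
    (h.tendsto_map_normalizedPair hη hα h0) (E := C) hfr
  simp only [ProbabilityMeasure.coe_mk] at h1
  rw [Measure.map_apply (hη.measurable_poissonPair α) hCc.measurableSet] at h1
  have h2 : poissonPair η α ⁻¹' C = {ω | ∫ z in unitSquare, z.2 ∂(η ω) ≤ 1} := by
    ext ω
    simp [hC, poissonPair]
  rw [h2] at h1
  refine h1.congr' ?_
  filter_upwards [eventually_ge_atTop 2] with n hn
  rw [map_normalizedPair_apply θ n hCc.measurableSet, normalizedPair_preimage_le_one θ hn]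

theorem RegularlyGrowing.le_liminf_harmonicLaw
    (hη : IsPoissonRandomMeasure η dickmanIntensity P) {θ : ℝ → ℝ} {α : ℝ}
    (h : RegularlyGrowing θ α) (hα : 0 < α) (h0 : θ 0 = 0) {G : Set ℝ} (hG : IsOpen G) :
    cond P {ω | ∫ z in unitSquare, z.2 ∂(η ω) ≤ 1}
        ((fun ω => ∫ z in unitSquare, z.2 ^ α ∂(η ω)) ⁻¹' G)
      ≤ liminf (fun n : ℕ => harmonicLaw n
        ((fun k => iota θ k / θ (Real.log n)) ⁻¹' G)) atTop := by
  set B := {ω | ∫ z in unitSquare, z.2 ∂(η ω) ≤ 1} with hB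
  set D := (fun ω => ∫ z in unitSquare, z.2 ^ α ∂(η ω)) ⁻¹' G with hD
  have hBm : MeasurableSet B := measurableSet_le hη.measurable_setIntegral measurable_const
  have hpos : P B ≠ 0 := hη.measure_setIntegral_le_one_pos.ne'
  -- The strict inequality makes `U` open; it loses only the null event `∫ x dη = 1`.
  set U : Set (EuclideanSpace ℝ (Fin 2)) := {x | x 0 ∈ G ∧ x 1 < 1} with hU
  have hUo : IsOpen U :=
    (hG.preimage (by fun_prop : Continuous fun x : EuclideanSpace ℝ (Fin 2) => x 0)).inter
      (isOpen_lt (by fun_prop : Continuous fun x : EuclideanSpace ℝ (Fin 2) => x 1)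
        continuous_const)
  have hPU : P (B ∩ D) ≤ P.map (poissonPair η α) U := by
    rw [Measure.map_apply (hη.measurable_poissonPair α) hUo.measurableSet]
    have hsub : B ∩ D ⊆ poissonPair η α ⁻¹' U ∪ {ω | ∫ z in unitSquare, z.2 ∂(η ω) = 1} := by
      rintro ω ⟨hω1, hω2⟩
      rcases lt_or_eq_of_le (show ∫ z in unitSquare, z.2 ∂(η ω) ≤ 1 from hω1) with h3 | h3
      · left
        have hω2' : ∫ z in unitSquare, z.2 ^ α ∂(η ω) ∈ G := hω2
        simpa [hU, poissonPair] using ⟨hω2', h3⟩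
      · exact Or.inr h3
    refine (measure_mono hsub).trans ((measure_union_le _ _).trans ?_)
    rw [h.measure_setIntegral_eq_one hη hα h0, add_zero]
  have hlow := hPU.trans (ProbabilityMeasure.le_liminf_measure_open_of_tendsto
    (h.tendsto_map_normalizedPair hη hα h0) hUo)
  simp only [ProbabilityMeasure.coe_mk] at hlow
  refine le_of_forall_lt fun c hc => ?_
  obtain ⟨c', hcc', hc'⟩ := exists_between hc
  have hctop : c' ≠ ∞ := hc'.ne_top
  refine hcc'.trans_le (le_liminf_of_le (by isBoundedDefault) ?_)
  rw [cond_apply hBm, ← ENNReal.div_eq_inv_mul,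
    ENNReal.lt_div_iff_mul_lt (Or.inl hpos) (Or.inl (measure_ne_top _ _))] at hc'
  -- The level `d` separates `c' Q_n(k ≤ n)`, eventually below it, from `Q_n` of the preimage of
  -- `U`, eventually above it; the factor `Q_n(k ≤ n)` then cancels.
  obtain ⟨d, hd1, hd2⟩ := exists_between (hc'.trans_le hlow)
  have hq := ENNReal.Tendsto.const_mul (h.tendsto_smoothLaw_Iic hη hα h0) (a := c')
    (Or.inr hctop)
  filter_upwards [hq.eventually (gt_mem_nhds hd1), eventually_lt_of_lt_liminf hd2,
    eventually_ge_atTop 2] with n h1 h2 hn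
  rw [map_normalizedPair_apply θ n hUo.measurableSet] at h2
  have h3 : normalizedPair θ n ⁻¹' U
      ⊆ (fun k => iota θ k / θ (Real.log n)) ⁻¹' G ∩ Set.Iic n := by
    rw [← normalizedPair_preimage_le_one θ hn]
    intro k hk
    refine ⟨?_, ?_⟩
    · simpa [normalizedPair] using hk.1
    · exact (show normalizedPair θ n k 1 < 1 from hk.2).le
  have h4 := h1.trans (h2.trans_le (measure_mono h3))
  rw [← harmonicLaw_mul_smoothLaw (by omega)] at h4
  exact (lt_of_mul_lt_mul_right' h4).le

/-- In the decreasing case `-θ` is regularly growing, and the normalised ratio is unchanged because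
`iota` is linear in `θ`. -/
theorem le_liminf_harmonicLaw_of_isDegree
    (hη : IsPoissonRandomMeasure η dickmanIntensity P) {θ : ℝ → ℝ} {α : ℝ}
    (hθ : IsDegree θ α) (hα : 0 < α) (h0 : θ 0 = 0)
    (hmono : ∃ a : ℝ, AntitoneOn θ (Set.Ici a) ∨ MonotoneOn θ (Set.Ici a))
    {G : Set ℝ} (hG : IsOpen G) :
    cond P {ω | ∫ z in unitSquare, z.2 ∂(η ω) ≤ 1}
        ((fun ω => ∫ z in unitSquare, z.2 ^ α ∂(η ω)) ⁻¹' G)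
      ≤ liminf (fun n : ℕ => harmonicLaw n
        ((fun k => iota θ k / θ (Real.log n)) ⁻¹' G)) atTop := by
  obtain ⟨a, ha | ha⟩ := hmono
  · have h : RegularlyGrowing (fun x => -θ x) α := regularlyGrowing_of_monotoneOn hα
      (fun t ht => by simpa only [neg_div_neg_eq] using hθ.tendsto_mul ht) ha.neg
    have hneg : ∀ k, iota (fun x => -θ x) k = -iota θ k := fun k => by
      simp [iota, Finsupp.sum]
    simpa only [hneg, neg_div_neg_eq] using
      h.le_liminf_harmonicLaw hη hα (by simp [h0]) hG
  · exact (regularlyGrowing_of_monotoneOn hα (fun t ht => hθ.tendsto_mul ht)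
      ha).le_liminf_harmonicLaw hη hα h0 hG

end Limit

end HarmonicAdditive

theorem theorem1
    (θ : ℝ → ℝ) (hzero : θ 0 = 0)
    (hsmooth : ContDiffOn ℝ 1 θ (Set.Ioi 0))
    (hV : θ ∈ HarmonicAdditive.ClassV)
    (hdeg : 0 < HarmonicAdditive.degree θ)
    (hmono : ∃ a : ℝ, AntitoneOn θ (Set.Ici a) ∨ MonotoneOn θ (Set.Ici a))
    -- the harmonic samples
    {Ω' : ℕ → Type*} [∀ n, MeasurableSpace (Ω' n)]
    (P' : (n : ℕ) → Measure (Ω' n)) [∀ n, IsProbabilityMeasure (P' n)]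
    (H : (n : ℕ) → Ω' n → ℕ) (hHmeas : ∀ n, Measurable (H n))
    (hH : ∀ n, 1 ≤ n → HasLaw (H n) (HarmonicAdditive.harmonicLaw n) (P' n))
    -- the Poisson random measure
    {Ω : Type*} [MeasurableSpace Ω] (P : Measure Ω) [IsProbabilityMeasure P]
    (η : Ω → Measure (ℝ × ℝ))
    (hη : HarmonicAdditive.IsPoissonRandomMeasure η HarmonicAdditive.dickmanIntensity P) :
    (∀ᵐ ω ∂P, IntegrableOn (fun z : ℝ × ℝ => z.2 ^ HarmonicAdditive.degree θ)
      HarmonicAdditive.unitSquare (η ω)) ∧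
    (∀ᵐ ω ∂P, IntegrableOn (fun z : ℝ × ℝ => z.2) HarmonicAdditive.unitSquare (η ω)) ∧
    ∃ _ : IsProbabilityMeasure
        (cond P {ω | ∫ z in HarmonicAdditive.unitSquare, z.2 ∂(η ω) ≤ 1}),
      TendstoInDistribution
        (fun n ω => HarmonicAdditive.iota θ (H n ω) / θ (Real.log n)) atTop
        (fun ω => ∫ z in HarmonicAdditive.unitSquare, z.2 ^ HarmonicAdditive.degree θ ∂(η ω))
        P' (cond P {ω | ∫ z in HarmonicAdditive.unitSquare, z.2 ∂(η ω) ≤ 1}) := by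
  have hprob : IsProbabilityMeasure
      (cond P {ω | ∫ z in HarmonicAdditive.unitSquare, z.2 ∂(η ω) ≤ 1}) :=
    cond_isProbabilityMeasure hη.measure_setIntegral_le_one_pos.ne'
  refine ⟨hη.ae_integrableOn_rpow hdeg, by simpa using hη.ae_integrableOn_rpow one_pos, hprob, ?_⟩
  have hlimm := hη.measurable_setIntegral_rpow (HarmonicAdditive.degree θ)
  have hm : ∀ n, Measurable fun ω => HarmonicAdditive.iota θ (H n ω) / θ (Real.log n) := fun n =>
    (Measurable.of_discrete (f := fun k => HarmonicAdditive.iota θ k / θ (Real.log n))).comp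
      (hHmeas n)
  refine ⟨fun n => (hm n).aemeasurable, hlimm.aemeasurable, ?_⟩
  -- By the portmanteau theorem, lower bounds on open sets are enough for weak convergence.
  refine tendsto_of_forall_isOpen_le_liminf' fun G hG => ?_
  simp only [ProbabilityMeasure.coe_mk]
  rw [Measure.map_apply hlimm hG.measurableSet]
  refine (HarmonicAdditive.le_liminf_harmonicLaw_of_isDegree hη
    (HarmonicAdditive.isDegree_degree hV) hdeg hzero hmono hG).trans (le_of_eq ?_)
  refine liminf_congr ?_
  filter_upwards [eventually_ge_atTop 1] with n hn
  rw [Measure.map_apply (hm n) hG.measurableSet, ← (hH n hn).map_eq,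
    Measure.map_apply (hHmeas n) (Set.to_countable _).measurableSet]
  rfl
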